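/- Let $\mathcal A$ be a C*-algebra (not necessarily unital), $\mathcal H$ a Hilbert space, and $u:\mathcal A\to\mathcal B(\mathcal H)$ a bounded algebra homomorphism (not assumed to preserve adjoints or units). Put $\mathcal B:=u(\mathcal A)$, and let $\tilde u:\mathcal A/\ker u\to\mathcal B$ be the induced algebra isomorphism, where $\mathcal A/\ker u$ has the quotient norm and $\mathcal B$ the operator norm. Give $M_n(\mathcal A)$ its C*-norm, and $M_{m,n}(\mathcal B)\subseteq M_{m,n}(\mathcal B(\mathcal H))=\mathcal B(\mathcal H^n,\mathcal H^m)$ the operator norm. Write $u_n:M_n(\mathcal A)\to M_n(\mathcal B)$ for the entrywise application of $u$ and $\|u\|_{cb}:=\sup_n\|u_n\|$; $u$ is completely bounded if $\|u\|_{cb}<\infty$. For $X\in M_n(\mathcal B)$ let $$\eta_n(X):=\sup\{\|RXC\| : R\in M_{1,n}(\mathcal B),\ C\in M_{n,1}(\mathcal B),\ \|R\|\le 1,\ \|C\|\le 1\}.$$ For a real number $\lambda>0$, say that $\mathcal B$ $\lambda$-norms itself if $\lambda\|X\|\le\eta_n(X)$ for all $n\in\mathbb N$ and $X\in M_n(\mathcal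 B)$. Then $\tilde u^{-1}$ is bounded, and the following hold. (1) If $\mathcal B$ $\lambda$-norms itself for some $\lambda>0$, then $u$ is completely bounded and $$\|u\|_{cb}\le\lambda^{-1}\|u\|^9\,\|\tilde u^{-1}\|^2 .$$ (2) Conversely, if $u$ is completely bounded, then $\mathcal B$ $\lambda$-norms itself for every $\lambda$ with $$0<\lambda\le\frac{1}{\|u\|_{cb}\,\|\tilde u^{-1}\|\,\|u\|^4}$$ (where the right-hand side is $+\infty$ if $u=0$). -/

import Mathlib

open scoped ENNReal

noncomputable section

namespace KadisonNorming

/-- The norm of a linear map, as an extended nonnegative real number: the supremum of `‖f x‖` over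
the closed unit ball. The map is bounded exactly when this is finite. -/
def opENorm {E F : Type*} [SeminormedAddCommGroup E] [Module ℂ E]
    [SeminormedAddCommGroup F] [Module ℂ F] (f : E →ₗ[ℂ] F) : ℝ≥0∞ :=
  ⨆ (x : E) (_ : ‖x‖ ≤ 1), ‖f x‖ₑ

section Matrices

variable {H : Type*} [NormedAddCommGroup H] [InnerProductSpace ℂ H]

/-- The bounded operator from the Hilbert space direct sum `H ⊕ ⋯ ⊕ H` (`n` summands) to
`H ⊕ ⋯ ⊕ H` (`m` summands) given by an `m × n` matrix of bounded operators on `H`. -/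
def matOp {m n : ℕ} (X : Matrix (Fin m) (Fin n) (H →L[ℂ] H)) :
    PiLp 2 (fun _ : Fin n => H) →L[ℂ] PiLp 2 (fun _ : Fin m => H) :=
  ((PiLp.continuousLinearEquiv 2 ℂ (fun _ : Fin m => H)).symm :
      (Fin m → H) →L[ℂ] PiLp 2 (fun _ : Fin m => H)) ∘L
    ContinuousLinearMap.pi fun i =>
      ∑ j, X i j ∘L (PiLp.proj 2 (fun _ : Fin n => H) j : PiLp 2 (fun _ : Fin n => H) →L[ℂ] H)

theorem matOp_apply {m n : ℕ} (X : Matrix (Fin m) (Fin n) (H →L[ℂ] H))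
    (x : PiLp 2 (fun _ : Fin n => H)) (i : Fin m) :
    matOp X x i = ∑ j, X i j (x j) := by
  simp [matOp]

/-- The norm of `M_{m,n}(B)` for an algebra `B` of operators on `H`, inherited from
`M_{m,n}(B(H)) = B(H^n, H^m)`. -/
def matENorm {B : NonUnitalSubalgebra ℂ (H →L[ℂ] H)} {m n : ℕ}
    (X : Matrix (Fin m) (Fin n) B) : ℝ≥0∞ :=
  ‖matOp (X.map fun b => (b : H →L[ℂ] H))‖ₑ

/-- `η_n(X) = sup ‖R X C‖`, over the rows `R` and the columns `C` with entries in `B` of norm at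
most one, where `B` is seen as a bimodule over itself. -/
def eta {B : NonUnitalSubalgebra ℂ (H →L[ℂ] H)} {n : ℕ}
    (X : Matrix (Fin n) (Fin n) B) : ℝ≥0∞ :=
  ⨆ (R : Matrix (Fin 1) (Fin n) B) (C : Matrix (Fin n) (Fin 1) B)
    (_ : matENorm R ≤ 1) (_ : matENorm C ≤ 1), matENorm (R * X * C)

/-- The algebra `B` of operators `lam`-norms itself. -/
def NormsItself (lam : ℝ) (B : NonUnitalSubalgebra ℂ (H →L[ℂ] H)) : Prop :=
  ∀ (n : ℕ) (X : Matrix (Fin n) (Fin n) B), ENNReal.ofReal lam * matENorm X ≤ eta X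

end Matrices

section Representations

variable {A : Type*} [NonUnitalCStarAlgebra A]
  {H : Type*} [NormedAddCommGroup H] [InnerProductSpace ℂ H]

/-- The completely bounded norm `sup_n ‖u_n‖` of a homomorphism `u : A → B(H)`, as an extended
nonnegative real number; `M_n(A)` carries its C⋆-norm. -/
def cbENorm [PartialOrder A] [StarOrderedRing A] (u : A →ₙₐ[ℂ] (H →L[ℂ] H)) : ℝ≥0∞ :=
  ⨆ (n : ℕ) (T : CStarMatrix (Fin n) (Fin n) A) (_ : ‖T‖ ≤ 1),
    ‖matOp (Matrix.of fun i j => u (T i j))‖ₑ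

/-- `u` is completely bounded. -/
def IsCompletelyBounded [PartialOrder A] [StarOrderedRing A] (u : A →ₙₐ[ℂ] (H →L[ℂ] H)) : Prop :=
  cbENorm u < ∞

/-- The induced isomorphism from `A ⧸ ker u` (with the quotient norm of `A`) onto the image
of `u`. -/
def inducedEquiv (u : A →ₙₐ[ℂ] (H →L[ℂ] H)) :
    (A ⧸ LinearMap.ker (u : A →ₗ[ℂ] (H →L[ℂ] H))) ≃ₗ[ℂ] NonUnitalAlgHom.range u :=
  (u : A →ₗ[ℂ] (H →L[ℂ] H)).quotKerEquivRange.trans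
    (LinearEquiv.ofEq _ (NonUnitalAlgHom.range u).toSubmodule (by ext; simp))

theorem inducedEquiv_mk (u : A →ₙₐ[ℂ] (H →L[ℂ] H)) (a : A) :
    (inducedEquiv u (Submodule.Quotient.mk a) : H →L[ℂ] H) = u a := rfl

/-- The norm of the bounded homomorphism `u`. -/
def repENorm (u : A →ₙₐ[ℂ] (H →L[ℂ] H)) : ℝ≥0∞ :=
  opENorm (u : A →ₗ[ℂ] (H →L[ℂ] H))

/-- The norm of the inverse of the induced isomorphism, as a map from the image of `u` with the
operator norm to `A ⧸ ker u` with the quotient norm. -/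
def inducedInvENorm (u : A →ₙₐ[ℂ] (H →L[ℂ] H)) : ℝ≥0∞ :=
  opENorm (E := NonUnitalAlgHom.range u)
    (F := A ⧸ LinearMap.ker (u : A →ₗ[ℂ] (H →L[ℂ] H))) (inducedEquiv u).symm.toLinearMap

end Representations

end KadisonNorming

end

/-!
Three facts carry the argument.

*Norms of lifts.* If `φ` is a bounded homomorphism and `b` is self-adjoint with `‖φ b‖ < r`, then
`φ (g b) = 0` for every bounded continuous `g` vanishing on `(-∞, r]`: the element `g b` equals
`b ^ k * (g / t ^ k) b`, and the image of this has norm at most a constant times `(‖φ b‖ / r) ^ k`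
(`map_cfcₙ_eq_zero`). Cutting the spectrum of `star a * a` at `r` gives an element with the same
image as `a` and norm at most `√r`, as soon as `‖φ (star a * a)‖ < r` (`exists_eq_norm_sq_le`). It
follows that the kernel of `u` is self-adjoint, that `A ⧸ ker u` is a C⋆-algebra (`KerQuotient`),
that an injective bounded homomorphism is bounded below by the inverse of its norm
(`norm_le_mul_norm_map`, whence the boundedness of the inverse), and that matrices over the quotient
lift with almost the same norm (`exists_matrix_lift_norm_le`).

*Columns and rows.* A bounded homomorphism `v : Q → B(H)` of norm at most `K` satisfies
`∑ ‖v (a i) h‖ ^ 2 ≤ K ^ 4 * ‖∑ star (a i) * a i‖ * ‖h‖ ^ 2` (`sum_norm_sq_map_apply_le`), and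
the same for rows by taking adjoints, so that columns and rows are mapped with norm at most `K ^ 2`.
If `T : E → H` is linear on a unital C⋆-algebra, bounded by `M` on the unitary group, and almost
attains `M` at `1`, then comparing `T` at `1` and at the unitaries `√(1 - t² x²) ± i t x` to
second order in `t` gives `‖T x‖ ^ 2 ≤ M * re ⟪ξ, T (x * x)⟫` up to an error, for self-adjoint `x`
and a unit vector `ξ` in the direction of `T 1`; summing gives the square estimate for self-adjoint
elements (`sum_norm_sq_map_le`). A unitary at which the supremum is almost attained can be moved to
`1`, and an arbitrary `a` is replaced by its modulus through a polar decomposition, at the cost of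
one more factor `K`, since `v` is multiplicative.

*Matrices.* The norm of `Y ∈ M_n(Q)` is the best constant `C` in
`‖r Y c‖ ≤ C * ‖r‖ * ‖c‖` for rows `r` and columns `c` over `Q`. Let `v : Q → B(H)` be the
injective homomorphism induced by `u`, and `κ` the norm of its inverse. A row or column over the
image of norm at most one comes from one over `Q` of norm at most `κ * K ^ 2`, because
`κ⁻¹ * ‖star c * c‖ ≤ ‖v (star c * c)‖ ≤ ‖v (star c)‖ * ‖v c‖ ≤ K ^ 2 * ‖c‖`; hence
`η (v Y) ≤ K * (κ * K ^ 2) ^ 2 * ‖Y‖ ≤ K ^ 9 * κ ^ 2 * ‖Y‖` (`eta_le`; `K ≥ 1` if `v ≠ 0`),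
which bounds the completely bounded norm when the image norms itself. Conversely, rows and columns
over `Q` of norm at most one have images of norm at most `K ^ 2`, so `‖Y‖ ≤ κ * K ^ 4 * η (v Y)`
(`norm_le_mul_eta`), and complete boundedness compares `‖Y‖` with `‖v Y‖`.
-/

noncomputable section

namespace KadisonNorming

/-! ### Functional calculus and norms of lifts -/

/-- A bounded homomorphism with `‖φ b‖ < r` does not see the part of the spectrum of `b` beyond
`r`. -/
theorem map_cfcₙ_eq_zero {A R : Type*} [NonUnitalCStarAlgebra A] [NonUnitalNormedRing R]
    (φ : A →ₙ+* R) {K : ℝ} (hφ : ∀ a, ‖φ a‖ ≤ K * ‖a‖) {b : A} (hb : IsSelfAdjoint b) {r : ℝ}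
    (hr : ‖φ b‖ < r) {g : ℝ → ℝ} (hg : Continuous g) (hg0 : ∀ t ≤ r, g t = 0)
    {C : ℝ} (hgC : ∀ t, |g t| ≤ C) :
    φ (cfcₙ g b) = 0 := by
  have hr0 : 0 < r := (norm_nonneg _).trans_lt hr
  have hK : 0 ≤ max K 0 := le_max_right _ _
  have hφ' : ∀ a, ‖φ a‖ ≤ max K 0 * ‖a‖ := fun a =>
    (hφ a).trans (by gcongr; exact le_max_left _ _)
  have hC : 0 ≤ C := (abs_nonneg _).trans (hgC 0)
  have hmax : ∀ t, 0 < max t r := fun t => lt_max_of_lt_right hr0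
  -- `g b = b ^ k * (w k) b`; the denominator may be `max t r`, since `g` vanishes for `t ≤ r`
  let w : ℕ → ℝ → ℝ := fun k t => g t / max t r ^ k
  have hwc : ∀ k, Continuous (w k) := fun k =>
    hg.div (by fun_prop) fun t => (pow_pos (hmax t) k).ne'
  have hw0 : ∀ k, w k 0 = 0 := fun k => by simp [w, hg0 0 hr0.le]
  have hstep : ∀ k, cfcₙ (w k) b = b * cfcₙ (w (k + 1)) b := by
    intro k
    have h1 : w k = fun t => t * w (k + 1) t := by
      funext t
      rcases le_total t r with h | h
      · simp [w, hg0 t h]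
      · have : t ≠ 0 := (hr0.trans_le h).ne'
        simp only [w, max_eq_left h]
        field_simp
        ring
    conv_lhs => rw [h1]
    rw [cfcₙ_mul (fun t => t) (w (k + 1)) b (by fun_prop) (by simp) (hwc _).continuousOn (hw0 _),
      cfcₙ_id' ℝ b]
  have hbound : ∀ k, ‖φ (cfcₙ (w 0) b)‖ ≤ ‖φ b‖ ^ k * ‖φ (cfcₙ (w k) b)‖ := by
    intro k
    induction k with
    | zero => simp
    | succ k ih =>
      refine ih.trans ?_
      rw [hstep k, map_mul, pow_succ, mul_assoc]
      gcongr
      exact norm_mul_le _ _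
  have hnorm : ∀ k, ‖cfcₙ (w k) b‖ ≤ C / r ^ k := by
    intro k
    refine norm_cfcₙ_le fun t _ => ?_
    rw [Real.norm_eq_abs, abs_div, abs_of_pos (pow_pos (hmax t) k)]
    gcongr
    · exact hgC t
    · exact le_max_right _ _
  have hlim : ∀ k : ℕ, ‖φ (cfcₙ (w 0) b)‖ ≤ max K 0 * C * (‖φ b‖ / r) ^ k := by
    intro k
    calc _ ≤ ‖φ b‖ ^ k * (max K 0 * (C / r ^ k)) :=
          (hbound k).trans (by gcongr; exact (hφ' _).trans (by gcongr; exact hnorm k))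
      _ = _ := by rw [div_pow]; ring
  have h0 : Filter.Tendsto (fun k : ℕ => max K 0 * C * (‖φ b‖ / r) ^ k) Filter.atTop (nhds 0) := by
    simpa using (tendsto_pow_atTop_nhds_zero_of_lt_one (by positivity)
      ((div_lt_one hr0).2 hr)).const_mul (max K 0 * C)
  have hfin : ‖φ (cfcₙ (w 0) b)‖ ≤ 0 := ge_of_tendsto' h0 hlim
  have hwg : w 0 = g := by funext t; simp [w]
  rw [hwg] at hfin
  exact norm_le_zero_iff.1 hfin

/-- The element `a'` is `a * √(r / max b r)` with `b = star a * a`: this differs from `a` by an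
element of the kernel, and its modulus is cut off at `√r`. -/
theorem exists_eq_norm_sq_le {A R : Type*} [NonUnitalCStarAlgebra A] [NonUnitalNormedRing R]
    (φ : A →ₙ+* R) {K : ℝ} (hφ : ∀ a, ‖φ a‖ ≤ K * ‖a‖) (a : A) {r : ℝ}
    (hr : ‖φ (star a * a)‖ < r) :
    ∃ a', φ a' = φ a ∧ ‖a'‖ ^ 2 ≤ r := by
  let _ := CStarAlgebra.spectralOrder A
  have := CStarAlgebra.spectralOrderedRing A
  have hr0 : 0 < r := (norm_nonneg _).trans_lt hr
  have hmax : ∀ t, 0 < max t r := fun t => lt_max_of_lt_right hr0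
  set b := star a * a with hbdef
  have hb : IsSelfAdjoint b := IsSelfAdjoint.star_mul_self a
  -- the factor `√(r / max t r)` is written as `1 - g t`, as `A` may lack a unit
  let g : ℝ → ℝ := fun t => 1 - √(r / max t r)
  have hgc : Continuous g :=
    continuous_const.sub (Real.continuous_sqrt.comp
      (continuous_const.div (by fun_prop) fun t => (hmax t).ne'))
  have hg0 : ∀ t ≤ r, g t = 0 := fun t ht => by
    simp [g, max_eq_right ht, div_self hr0.ne']
  have hsq : ∀ t, √(r / max t r) ≤ 1 := fun t =>
    Real.sqrt_le_one.2 ((div_le_one (hmax t)).2 (le_max_right _ _))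
  have hg1 : ∀ t, |g t| ≤ 1 := fun t => by
    rw [abs_of_nonneg (by simp only [g]; linarith [hsq t])]
    simp only [g]; linarith [Real.sqrt_nonneg (r / max t r)]
  have hg00 : g 0 = 0 := hg0 0 hr0.le
  refine ⟨a - a * cfcₙ g b, ?_, ?_⟩
  · rw [map_sub, map_mul, map_cfcₙ_eq_zero φ hφ hb hr hgc hg0 hg1, mul_zero, sub_zero]
  · have hcs : star (cfcₙ g b) = cfcₙ g b := (cfcₙ_predicate g b).star_eq
    have h1 : star (a - a * cfcₙ g b) * (a - a * cfcₙ g b)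
        = b - b * cfcₙ g b - cfcₙ g b * b + cfcₙ g b * b * cfcₙ g b := by
      rw [star_sub, star_mul, hcs, hbdef]; noncomm_ring
    have h2 : b - b * cfcₙ g b - cfcₙ g b * b + cfcₙ g b * b * cfcₙ g b
        = cfcₙ (fun t => t - t * g t - g t * t + g t * t * g t) b := by
      have hid : ContinuousOn (fun t : ℝ => t) (quasispectrum ℝ b) := by fun_prop
      have hgo : ContinuousOn g (quasispectrum ℝ b) := hgc.continuousOn
      rw [cfcₙ_add (fun t => t - t * g t - g t * t) (fun t => g t * t * g t) b
          (by fun_prop) (by simp) (by fun_prop) (by simp),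
        cfcₙ_sub (fun t => t - t * g t) (fun t => g t * t) b (by fun_prop) (by simp)
          (by fun_prop) (by simp),
        cfcₙ_sub (fun t => t) (fun t => t * g t) b (by fun_prop) (by simp)
          (by fun_prop) (by simp),
        cfcₙ_mul (fun t => g t * t) g b (by fun_prop) (by simp) hgo hg00,
        cfcₙ_mul g (fun t => t) b hgo hg00 hid rfl,
        cfcₙ_mul (fun t => t) g b hid rfl hgo hg00, cfcₙ_id' ℝ b]
    rw [sq, ← CStarRing.norm_star_mul_self, h1, h2]
    refine norm_cfcₙ_le fun t ht => ?_
    have ht0 : 0 ≤ t := quasispectrum_nonneg_of_nonneg b (star_mul_self_nonneg a) t ht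
    have h3 : t - t * g t - g t * t + g t * t * g t = t * (r / max t r) := by
      have := Real.sq_sqrt (div_nonneg hr0.le (hmax t).le)
      simp only [g]
      linear_combination t * this
    rw [h3, Real.norm_eq_abs, abs_of_nonneg (mul_nonneg ht0 (div_nonneg hr0.le (hmax t).le)),
      mul_div_assoc', div_le_iff₀ (hmax t), mul_comm]
    gcongr
    exact le_max_left _ _

theorem norm_sq_le_norm_map_star_mul_self {A R : Type*} [NonUnitalCStarAlgebra A]
    [NonUnitalNormedRing R] (φ : A →ₙ+* R) (hinj : Function.Injective φ) {K : ℝ}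
    (hφ : ∀ a, ‖φ a‖ ≤ K * ‖a‖) (a : A) : ‖a‖ ^ 2 ≤ ‖φ (star a * a)‖ := by
  refine le_of_forall_gt_imp_ge_of_dense fun r hr => ?_
  obtain ⟨a', ha', hle⟩ := exists_eq_norm_sq_le φ hφ a hr
  rwa [hinj ha'] at hle

theorem norm_le_mul_norm_map {A R : Type*} [NonUnitalCStarAlgebra A] [NonUnitalNormedRing R]
    (φ : A →ₙ+* R) (hinj : Function.Injective φ) {K : ℝ} (hφ : ∀ a, ‖φ a‖ ≤ K * ‖a‖) (a : A) :
    ‖a‖ ≤ K * ‖φ a‖ := by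
  have h1 := norm_sq_le_norm_map_star_mul_self φ hinj hφ a
  rcases (norm_nonneg a).eq_or_lt with h | h
  · have : a = 0 := norm_eq_zero.1 h.symm
    simp [this]
  · refine le_of_mul_le_mul_left ?_ h
    calc ‖a‖ * ‖a‖ ≤ ‖φ (star a) * φ a‖ := by rw [← sq, ← map_mul]; exact h1
      _ ≤ ‖φ (star a)‖ * ‖φ a‖ := norm_mul_le _ _
      _ ≤ K * ‖a‖ * ‖φ a‖ := by gcongr; simpa using hφ (star a)
      _ = _ := by ring

theorem one_le_of_norm_map_le {A R : Type*} [NonUnitalCStarAlgebra A] [NonUnitalNormedRing R]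
    (φ : A →ₙ+* R) (hinj : Function.Injective φ) {K : ℝ} (hφ : ∀ a, ‖φ a‖ ≤ K * ‖a‖) {a : A}
    (ha : a ≠ 0) : 1 ≤ K := by
  have h1 := (norm_sq_le_norm_map_star_mul_self φ hinj hφ a).trans (hφ _)
  rw [CStarRing.norm_star_mul_self, ← sq] at h1
  exact one_le_of_le_mul_right₀ (by positivity) h1

theorem map_star_eq_zero {A R : Type*} [NonUnitalCStarAlgebra A] [NonUnitalNormedRing R]
    (φ : A →ₙ+* R) {K : ℝ} (hφ : ∀ a, ‖φ a‖ ≤ K * ‖a‖) {a : A} (ha : φ a = 0) :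
    φ (star a) = 0 := by
  have key : ∀ r : ℝ, 0 < r → ‖φ (star a)‖ ≤ |K| * √r := by
    intro r hr
    obtain ⟨a', h1, h2⟩ := exists_eq_norm_sq_le φ hφ (star a) (r := r) (by simpa [ha] using hr)
    rw [← h1]
    refine (hφ a').trans ?_
    gcongr
    · exact le_abs_self K
    · exact Real.le_sqrt_of_sq_le h2
  have hlim : Filter.Tendsto (fun r : ℝ => |K| * √r) (nhdsWithin 0 (Set.Ioi 0)) (nhds 0) := by
    have : Continuous fun r : ℝ => |K| * √r := by fun_prop
    simpa using (this.tendsto 0).mono_left nhdsWithin_le_nhds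
  refine norm_le_zero_iff.1 (ge_of_tendsto hlim ?_)
  filter_upwards [self_mem_nhdsWithin] with r hr using key r hr

/-! ### The quotient by the kernel is a C⋆-algebra -/

section Quotient

variable {A R : Type*} [NonUnitalCStarAlgebra A] [NonUnitalNormedRing R] [NormedSpace ℂ R]

/-- The quotient of `A` by the kernel of a continuous homomorphism, with the quotient norm.
Continuity makes the kernel closed; it is an argument of the type so that the instances below, which depend on
it, can be found. -/
def KerQuotient {φ : A →ₙₐ[ℂ] R} (_hφ : Continuous φ) : Type _ :=
  A ⧸ LinearMap.ker (φ : A →ₗ[ℂ] R)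

namespace KerQuotient

variable {φ : A →ₙₐ[ℂ] R} (hφ : Continuous φ)

/-- The class of an element of `A`. -/
def mk (a : A) : KerQuotient hφ := Submodule.Quotient.mk (p := LinearMap.ker (φ : A →ₗ[ℂ] R)) a

variable {hφ}

theorem mk_surjective : Function.Surjective (mk hφ) := Submodule.Quotient.mk_surjective _

theorem quotientRel_iff (φ : A →ₙₐ[ℂ] R) {a b : A} :
    (LinearMap.ker (φ : A →ₗ[ℂ] R)).quotientRel a b ↔ φ a = φ b := by
  rw [Submodule.quotientRel_def, LinearMap.mem_ker, map_sub, sub_eq_zero]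
  rfl

theorem mk_eq_mk {a b : A} : mk hφ a = mk hφ b ↔ φ a = φ b :=
  Quotient.eq''.trans (quotientRel_iff φ)

instance : NormedAddCommGroup (KerQuotient hφ) :=
  have : IsClosed (LinearMap.ker (φ : A →ₗ[ℂ] R) : Set A) := isClosed_singleton.preimage hφ
  inferInstanceAs (NormedAddCommGroup (A ⧸ LinearMap.ker (φ : A →ₗ[ℂ] R)))

instance : NormedSpace ℂ (KerQuotient hφ) :=
  inferInstanceAs (NormedSpace ℂ (A ⧸ LinearMap.ker (φ : A →ₗ[ℂ] R)))

instance : CompleteSpace (KerQuotient hφ) :=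
  inferInstanceAs (CompleteSpace (A ⧸ LinearMap.ker (φ : A →ₗ[ℂ] R)))

theorem mk_add (a b : A) : mk hφ (a + b) = mk hφ a + mk hφ b := rfl

theorem mk_zero : mk hφ 0 = 0 := rfl

theorem mk_smul (c : ℂ) (a : A) : mk hφ (c • a) = c • mk hφ a := rfl

theorem norm_mk_le (a : A) : ‖mk hφ a‖ ≤ ‖a‖ :=
  Submodule.Quotient.norm_mk_le _ a

theorem exists_mk_eq_norm_lt (x : KerQuotient hφ) {ε : ℝ} (hε : 0 < ε) :
    ∃ a, mk hφ a = x ∧ ‖a‖ < ‖x‖ + ε :=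
  Submodule.Quotient.norm_mk_lt (S := LinearMap.ker (φ : A →ₗ[ℂ] R)) x hε

instance : Mul (KerQuotient hφ) where
  mul := Quotient.map₂ (· * ·) fun a b hab c d hcd => (quotientRel_iff φ).2 <| by
    simp [(quotientRel_iff φ).1 hab, (quotientRel_iff φ).1 hcd]

theorem mk_mul (a b : A) : mk hφ (a * b) = mk hφ a * mk hφ b := rfl

instance : NonUnitalRing (KerQuotient hφ) where
  left_distrib := mk_surjective.forall₃.2 fun a b c => by
    simp only [← mk_add, ← mk_mul, mul_add]
  right_distrib := mk_surjective.forall₃.2 fun a b c => by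
    simp only [← mk_add, ← mk_mul, add_mul]
  zero_mul := mk_surjective.forall.2 fun a => by simp only [← mk_zero, ← mk_mul, zero_mul]
  mul_zero := mk_surjective.forall.2 fun a => by simp only [← mk_zero, ← mk_mul, mul_zero]
  mul_assoc := mk_surjective.forall₃.2 fun a b c => by simp only [← mk_mul, mul_assoc]

instance : NonUnitalNormedRing (KerQuotient hφ) where
  dist_eq := NormedAddCommGroup.dist_eq
  norm_mul_le x y := by
    have hlim : Filter.Tendsto (fun ε : ℝ => (‖x‖ + ε) * (‖y‖ + ε))
        (nhdsWithin 0 (Set.Ioi 0)) (nhds (‖x‖ * ‖y‖)) := by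
      have : Continuous fun ε : ℝ => (‖x‖ + ε) * (‖y‖ + ε) := by fun_prop
      simpa using (this.tendsto 0).mono_left nhdsWithin_le_nhds
    refine ge_of_tendsto hlim ?_
    filter_upwards [self_mem_nhdsWithin] with ε hε
    obtain ⟨a, rfl, ha⟩ := exists_mk_eq_norm_lt x hε
    obtain ⟨b, rfl, hb⟩ := exists_mk_eq_norm_lt y hε
    rw [← mk_mul]
    exact (norm_mk_le _).trans ((norm_mul_le a b).trans (mul_le_mul ha.le hb.le (norm_nonneg b)
      ((norm_nonneg a).trans ha.le)))

variable (hφ) in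
/-- The quotient map as a ring homomorphism. It is needed before the involution of the quotient
is available. -/
def mkHom : A →ₙ+* KerQuotient hφ where
  toFun := mk hφ
  map_mul' := mk_mul
  map_zero' := rfl
  map_add' := mk_add

theorem norm_mkHom_le (a : A) : ‖mkHom hφ a‖ ≤ 1 * ‖a‖ := by
  rw [one_mul]; exact norm_mk_le a

/-- The kernel is self-adjoint. This follows from `map_star_eq_zero` for the quotient map, which has
norm at most one and the same kernel. -/
theorem map_star_eq_map_star {φ : A →ₙₐ[ℂ] R} (hφ : Continuous φ) {a b : A} (h : φ a = φ b) :
    φ (star a) = φ (star b) := by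
  refine (mk_eq_mk (hφ := hφ)).1 ?_
  have h0 : mkHom hφ (a - b) = 0 := by rw [map_sub, sub_eq_zero]; exact mk_eq_mk.2 h
  have := map_star_eq_zero (mkHom hφ) norm_mkHom_le h0
  rwa [star_sub, map_sub, sub_eq_zero] at this

instance : StarRing (KerQuotient hφ) where
  star := Quotient.map star fun _ _ hab =>
    (quotientRel_iff φ).2 (map_star_eq_map_star hφ ((quotientRel_iff φ).1 hab))
  star_involutive := mk_surjective.forall.2 fun a => congrArg (mk hφ) (star_star a)
  star_mul := mk_surjective.forall₂.2 fun a b => congrArg (mk hφ) (star_mul a b)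
  star_add := mk_surjective.forall₂.2 fun a b => congrArg (mk hφ) (star_add a b)

theorem mk_star (a : A) : mk hφ (star a) = star (mk hφ a) := rfl

/-- The C⋆-inequality for the quotient norm: a class whose `star a * a` has norm less than `r` has a
representative of norm at most `√r`. -/
instance : CStarRing (KerQuotient hφ) where
  norm_mul_self_le := mk_surjective.forall.2 fun a => by
    rw [← mk_star, ← mk_mul, ← sq]
    refine le_of_forall_gt_imp_ge_of_dense fun r hr => ?_
    obtain ⟨a', ha', hle⟩ := exists_eq_norm_sq_le (mkHom hφ) norm_mkHom_le a hr
    have ha'' : mk hφ a' = mk hφ a := ha'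
    rw [← ha'']
    exact (by gcongr; exact norm_mk_le a' : ‖mk hφ a'‖ ^ 2 ≤ ‖a'‖ ^ 2).trans hle

instance : NonUnitalCStarAlgebra (KerQuotient hφ) where
  smul_assoc c := mk_surjective.forall₂.2 fun a b => congrArg (mk hφ) (smul_assoc c a b)
  smul_comm c := mk_surjective.forall₂.2 fun a b => congrArg (mk hφ) (smul_comm c a b)
  star_smul c := mk_surjective.forall.2 fun a => congrArg (mk hφ) (star_smul c a)

variable (hφ) in
/-- The quotient map as a homomorphism of C⋆-algebras. -/
def mkStarHom : A →⋆ₙₐ[ℂ] KerQuotient hφ where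
  toFun := mk hφ
  map_smul' := mk_smul
  map_mul' := mk_mul
  map_zero' := rfl
  map_add' := mk_add
  map_star' := mk_star

variable (hφ) in
/-- The injective homomorphism induced by `φ` on the quotient by its kernel. -/
def lift : KerQuotient hφ →ₙₐ[ℂ] R where
  toFun := Quotient.lift φ fun _ _ hab => (quotientRel_iff φ).1 hab
  map_smul' c := mk_surjective.forall.2 fun a => map_smul φ c a
  map_zero' := map_zero φ
  map_add' := mk_surjective.forall₂.2 fun a b => map_add φ a b
  map_mul' := mk_surjective.forall₂.2 fun a b => map_mul φ a b

theorem lift_mk (a : A) : lift hφ (mk hφ a) = φ a := rfl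

theorem lift_injective : Function.Injective (lift hφ) :=
  mk_surjective.forall₂.2 fun _ _ h => mk_eq_mk.2 h

theorem norm_lift_le {K : ℝ} (hK0 : 0 ≤ K) (hK : ∀ a, ‖φ a‖ ≤ K * ‖a‖) (x : KerQuotient hφ) :
    ‖lift hφ x‖ ≤ K * ‖x‖ := by
  have hlim : Filter.Tendsto (fun ε : ℝ => K * (‖x‖ + ε))
      (nhdsWithin 0 (Set.Ioi 0)) (nhds (K * ‖x‖)) := by
    have : Continuous fun ε : ℝ => K * (‖x‖ + ε) := by fun_prop
    simpa using (this.tendsto 0).mono_left nhdsWithin_le_nhds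
  refine ge_of_tendsto hlim ?_
  filter_upwards [self_mem_nhdsWithin] with ε hε
  obtain ⟨a, rfl, ha⟩ := exists_mk_eq_norm_lt x hε
  rw [lift_mk]
  exact (hK a).trans (by gcongr)

end KerQuotient

end Quotient

/-! ### Linear maps that are bounded on the unitary group -/

section Unital

variable {E : Type*} [CStarAlgebra E] {H : Type*} [NormedAddCommGroup H] [InnerProductSpace ℂ H]

/-- A regularized polar decomposition: `x = √(star a * a + ε)` and `y` is its inverse, so that
`a = (a * y) * x` with a contraction `a * y`. -/
theorem exists_mul_eq_sq_eq (a : E) {ε : ℝ} (hε : 0 < ε) :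
    ∃ x y : E, IsSelfAdjoint x ∧ ‖a * y‖ ≤ 1 ∧ a * y * x = a ∧
      x * x = star a * a + (ε : ℂ) • 1 := by
  let _ := CStarAlgebra.spectralOrder E
  have := CStarAlgebra.spectralOrderedRing E
  have hspec : ∀ t ∈ spectrum ℝ (star a * a), 0 ≤ t := fun t ht =>
    spectrum_nonneg_of_nonneg (star_mul_self_nonneg a) ht
  have hb : IsSelfAdjoint (star a * a) := IsSelfAdjoint.star_mul_self a
  obtain ⟨b, hbdef⟩ : ∃ b, b = star a * a := ⟨_, rfl⟩
  rw [← hbdef] at hspec hb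
  have hpos : ∀ t, 0 < max t 0 + ε := fun t => by positivity
  obtain ⟨f, hfdef⟩ : ∃ f : ℝ → ℝ, f = fun t => √(max t 0 + ε) := ⟨_, rfl⟩
  have hff : ∀ t, f t * f t = max t 0 + ε := fun t => by
    rw [hfdef]; exact Real.mul_self_sqrt (hpos t).le
  have hf0 : ∀ t, f t ≠ 0 := fun t h => by
    have := hff t
    rw [h, mul_zero] at this
    exact (hpos t).ne this
  have hf : Continuous f := by rw [hfdef]; fun_prop
  obtain ⟨g, hgdef⟩ : ∃ g : ℝ → ℝ, g = fun t => (f t)⁻¹ := ⟨_, rfl⟩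
  have hg : Continuous g := by rw [hgdef]; exact hf.inv₀ hf0
  have hid : ContinuousOn (fun t : ℝ => t) (spectrum ℝ b) := continuousOn_id
  have hgs : star (cfc g b) = cfc g b := (cfc_predicate g b : IsSelfAdjoint _).star_eq
  refine ⟨cfc f b, cfc g b, cfc_predicate f b, ?_, ?_, ?_⟩
  · have h1 : star (a * cfc g b) * (a * cfc g b) = cfc (fun t => g t * t * g t) b := by
      rw [cfc_mul (fun t => g t * t) g b (hg.continuousOn.mul hid) hg.continuousOn,
        cfc_mul g (fun t => t) b hg.continuousOn hid, cfc_id' ℝ b hb, star_mul, hgs,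
        mul_assoc, ← mul_assoc (star a), ← hbdef, ← mul_assoc]
    rw [← sq_le_one_iff₀ (norm_nonneg _), sq, ← CStarRing.norm_star_mul_self, h1]
    refine norm_cfc_le zero_le_one fun t ht => ?_
    have ht0 := hspec t ht
    have h2 : g t * t * g t = t / (max t 0 + ε) := by
      rw [← hff t, hgdef]; field_simp
    rw [h2, max_eq_left ht0, Real.norm_eq_abs, abs_of_nonneg (by positivity),
      div_le_one (by positivity)]
    linarith
  · have h1 : cfc g b * cfc f b = 1 := by
      rw [← cfc_mul g f b hg.continuousOn hf.continuousOn, ← cfc_one ℝ b hb]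
      exact cfc_congr fun t _ => by rw [hgdef]; exact inv_mul_cancel₀ (hf0 t)
    rw [mul_assoc, h1, mul_one]
  · rw [← cfc_mul f f b hf.continuousOn hf.continuousOn]
    have h1 : cfc (fun t => f t * f t) b = cfc (fun t => t + ε) b :=
      cfc_congr fun t ht => (hff t).trans (by rw [max_eq_left (hspec t ht)])
    rw [h1, cfc_add_const ε (fun t => t) b hid hb, cfc_id' ℝ b hb,
      Algebra.algebraMap_eq_smul_one, hbdef, Complex.coe_smul]

/-- The element `s = √(1 - x²)`, which makes `s ± i x` unitary, and its expansion to second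
order. -/
theorem exists_sq_add_sq_eq_one {x : E} (hx : IsSelfAdjoint x) (hx1 : ‖x‖ ≤ 1) :
    ∃ s : E, IsSelfAdjoint s ∧ Commute x s ∧ x * x + s * s = 1 ∧
      ‖1 - (2⁻¹ : ℂ) • (x * x) - s‖ ≤ ‖x‖ ^ 4 := by
  rcases subsingleton_or_nontrivial E with hE | hE
  · refine ⟨0, .zero E, .zero_right x, Subsingleton.elim _ _, ?_⟩
    rw [Subsingleton.elim (1 - (2⁻¹ : ℂ) • (x * x) - 0) 0, norm_zero]
    positivity
  obtain ⟨f, hfdef⟩ : ∃ f : ℝ → ℝ, f = fun t => √(1 - t ^ 2) := ⟨_, rfl⟩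
  have hf : Continuous f := by rw [hfdef]; fun_prop
  have hf0 : ∀ t, 0 ≤ f t := fun t => by rw [hfdef]; positivity
  have hspec : ∀ t ∈ spectrum ℝ x, |t| ≤ ‖x‖ := fun t ht => spectrum.norm_le_norm_of_mem ht
  have hff : ∀ t ∈ spectrum ℝ x, f t * f t = 1 - t ^ 2 := fun t ht => by
    have : t ^ 2 ≤ 1 := by
      rw [← sq_abs]; exact pow_le_one₀ (abs_nonneg _) ((hspec t ht).trans hx1)
    rw [hfdef]
    exact Real.mul_self_sqrt (by linarith)
  have hxx : x * x = cfc (fun t : ℝ => t ^ 2) x := by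
    rw [cfc_pow_id (R := ℝ) x 2 hx, sq]
  have hcf := hf.continuousOn (s := spectrum ℝ x)
  refine ⟨cfc f x, cfc_predicate f x, ?_, ?_, ?_⟩
  · have := cfc_commute_cfc (fun t : ℝ => t) f x
    rwa [cfc_id' ℝ x hx] at this
  · rw [hxx, ← cfc_mul f f x hcf hcf,
      ← cfc_add x (fun t : ℝ => t ^ 2) (fun t => f t * f t) (by fun_prop) (hcf.mul hcf),
      ← cfc_one ℝ x hx]
    exact cfc_congr fun t ht => by
      change t ^ 2 + f t * f t = 1
      rw [hff t ht]; ring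
  · have h1 : 1 - (2⁻¹ : ℂ) • (x * x) - cfc f x = cfc (fun t : ℝ => 1 - 2⁻¹ * t ^ 2 - f t) x := by
      rw [cfc_sub (fun t : ℝ => 1 - 2⁻¹ * t ^ 2) f x (by fun_prop) hcf,
        cfc_sub (fun _ : ℝ => 1) (fun t : ℝ => 2⁻¹ * t ^ 2) x (by fun_prop) (by fun_prop),
        cfc_const_mul (2⁻¹ : ℝ) (fun t : ℝ => t ^ 2) x (by fun_prop), cfc_const_one ℝ x hx, ← hxx,
        ← Complex.coe_smul]
      simp
    rw [h1]
    refine norm_cfc_le (by positivity) fun t ht => ?_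
    have h2 := hff t ht
    have h3 := hf0 t
    have h4 : t ^ 4 ≤ ‖x‖ ^ 4 := by
      rw [← Even.pow_abs (by decide : Even 4)]
      exact pow_le_pow_left₀ (abs_nonneg _) (hspec t ht) 4
    have h5 : t ^ 2 ≤ 1 := by nlinarith [mul_self_nonneg (f t)]
    rw [Real.norm_eq_abs]
    refine le_trans ?_ h4
    -- multiply by `1 - t²/2 + f t ≥ 1/2`, which turns the difference into `t⁴/4`
    have h6 : (1 - 2⁻¹ * t ^ 2 - f t) * (1 - 2⁻¹ * t ^ 2 + f t) = t ^ 4 / 4 := by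
      linear_combination -h2
    have h7 : 2⁻¹ ≤ 1 - 2⁻¹ * t ^ 2 + f t := by linarith
    rw [abs_le]
    have h8 : 0 ≤ t ^ 4 := by positivity
    constructor <;> nlinarith

theorem isSelfAdjoint_mul_self {x : E} (hx : IsSelfAdjoint x) : IsSelfAdjoint (x * x) := by
  have := IsSelfAdjoint.star_mul_self x
  rwa [hx.star_eq] at this

theorem add_I_smul_mem_unitary {x s : E} (hx : IsSelfAdjoint x) (hs : IsSelfAdjoint s)
    (hxs : Commute x s) (h : x * x + s * s = 1) : s + Complex.I • x ∈ unitary E := by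
  have h1 : star (s + Complex.I • x) = s - Complex.I • x := by
    rw [star_add, star_smul, hx.star_eq, hs.star_eq, Complex.star_def, Complex.conj_I, neg_smul,
      sub_eq_add_neg]
  have hI : Complex.I • Complex.I • (x * x) = -(x * x) := by
    rw [smul_smul, Complex.I_mul_I, neg_one_smul]
  rw [Unitary.mem_iff, h1]
  constructor
  · rw [← h]
    simp only [sub_mul, mul_add, mul_smul_comm, smul_mul_assoc, smul_sub, hI,
      hxs.eq]
    abel
  · rw [← h]
    simp only [add_mul, mul_sub, mul_smul_comm, smul_mul_assoc, smul_add, hI,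
      hxs.eq]
    abel

theorem sub_I_smul_mem_unitary {x s : E} (hx : IsSelfAdjoint x) (hs : IsSelfAdjoint s)
    (hxs : Commute x s) (h : x * x + s * s = 1) : s - Complex.I • x ∈ unitary E := by
  have := add_I_smul_mem_unitary hx.neg hs hxs.neg_left (by rwa [neg_mul_neg])
  rwa [smul_neg, ← sub_eq_add_neg] at this

theorem norm_sq_map_add_norm_sq_map_le (T : E →ₗ[ℂ] H) {M : ℝ}
    (hT : ∀ v ∈ unitary E, ‖T v‖ ≤ M) {x s : E} (hx : IsSelfAdjoint x) (hs : IsSelfAdjoint s)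
    (hxs : Commute x s) (h : x * x + s * s = 1) : ‖T x‖ ^ 2 + ‖T s‖ ^ 2 ≤ M ^ 2 := by
  have h1 := hT _ (add_I_smul_mem_unitary hx hs hxs h)
  have h2 := hT _ (sub_I_smul_mem_unitary hx hs hxs h)
  have h3 := parallelogram_law_with_norm ℂ (T s) (Complex.I • T x)
  rw [norm_smul, Complex.norm_I, one_mul] at h3
  rw [map_add, map_smul] at h1
  rw [map_sub, map_smul] at h2
  have h4 := mul_self_le_mul_self (norm_nonneg _) h1
  have h5 := mul_self_le_mul_self (norm_nonneg _) h2
  nlinarith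

/-- The bound on the unitary group extends to self-adjoint elements without loss. -/
theorem norm_map_le_of_isSelfAdjoint (T : E →ₗ[ℂ] H) {M : ℝ} (hT : ∀ v ∈ unitary E, ‖T v‖ ≤ M)
    {x : E} (hx : IsSelfAdjoint x) : ‖T x‖ ≤ M * ‖x‖ := by
  have hM : 0 ≤ M := (norm_nonneg _).trans (hT 1 (one_mem _))
  rcases eq_or_ne x 0 with rfl | hx0
  · simp
  have hn : 0 < ‖x‖ := norm_pos_iff.2 hx0
  have hy : IsSelfAdjoint ((‖x‖⁻¹ : ℝ) • x) := (IsSelfAdjoint.all _).smul hx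
  have hy1 : ‖(‖x‖⁻¹ : ℝ) • x‖ ≤ 1 := by
    rw [norm_smul, norm_inv, norm_norm, inv_mul_cancel₀ hn.ne']
  obtain ⟨s, hs, hc, h, -⟩ := exists_sq_add_sq_eq_one hy hy1
  have h1 := norm_sq_map_add_norm_sq_map_le T hT hy hs hc h
  have h2 : ‖T ((‖x‖⁻¹ : ℝ) • x)‖ ≤ M :=
    le_of_sq_le_sq (by nlinarith [sq_nonneg ‖T s‖]) hM
  rw [← Complex.coe_smul, map_smul, norm_smul, Complex.norm_real, norm_inv, norm_norm,
    inv_mul_le_iff₀ hn] at h2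
  rwa [mul_comm]

/-- The second-order comparison of `T` at `1` and at the unitaries `s ± i t x`, `s = √(1 - t² x²)`:
by the parallelogram law `t² ‖T x‖² ≤ M² - ‖T s‖²`, while `‖T s‖ ≥ re ⟪ξ, T s⟫` and
`s = 1 - t² x² / 2 + O(t⁴)`. -/
theorem norm_sq_map_le (T : E →ₗ[ℂ] H) {M : ℝ} (hT : ∀ v ∈ unitary E, ‖T v‖ ≤ M) {δ : ℝ}
    {ξ : H} (hξ : ‖ξ‖ ≤ 1) (hξ1 : M - δ ≤ (inner ℂ ξ (T 1)).re) {x : E} (hx : IsSelfAdjoint x)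
    {t : ℝ} (ht : 0 < t) (htx : t * ‖x‖ ≤ 1) :
    ‖T x‖ ^ 2 ≤ M * (inner ℂ ξ (T (x * x))).re + 2 * M * (δ / t ^ 2 + M * t ^ 2 * ‖x‖ ^ 4) := by
  have hM : 0 ≤ M := (norm_nonneg _).trans (hT 1 (one_mem _))
  have hle : ∀ z, (inner ℂ ξ (T z)).re ≤ ‖T z‖ := fun z =>
    (re_inner_le_norm (𝕜 := ℂ) ξ (T z)).trans (mul_le_of_le_one_left (norm_nonneg _) hξ)
  have hn : ‖(t : ℂ) • x‖ = t * ‖x‖ := by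
    rw [norm_smul, Complex.norm_real, Real.norm_eq_abs, abs_of_pos ht]
  have hof : ∀ r : ℝ, IsSelfAdjoint (r : ℂ) := Complex.conj_ofReal
  have hy : IsSelfAdjoint ((t : ℂ) • x) := (hof t).smul hx
  obtain ⟨s, hs, hc, h, hρ⟩ := exists_sq_add_sq_eq_one hy (hn ▸ htx)
  have h1 := norm_sq_map_add_norm_sq_map_le T hT hy hs hc h
  have hyy : ((t : ℂ) • x) * ((t : ℂ) • x) = ((t ^ 2 : ℝ) : ℂ) • (x * x) := by
    rw [smul_mul_smul_comm]; push_cast; rw [sq]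
  rw [hn, hyy] at hρ
  have hρs : IsSelfAdjoint (1 - (2⁻¹ : ℂ) • (((t ^ 2 : ℝ) : ℂ) • (x * x)) - s) := by
    have hxx : IsSelfAdjoint (x * x) := isSelfAdjoint_mul_self hx
    have h2 : IsSelfAdjoint (2⁻¹ : ℂ) := by simp [isSelfAdjoint_iff]
    exact ((IsSelfAdjoint.one E).sub (h2.smul ((hof _).smul hxx))).sub hs
  have h2 := (hle _).trans ((norm_map_le_of_isSelfAdjoint T hT hρs).trans
    (mul_le_mul_of_nonneg_left hρ hM))
  have h3 : (inner ℂ ξ (T (1 - (2⁻¹ : ℂ) • (((t ^ 2 : ℝ) : ℂ) • (x * x)) - s))).re =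
      (inner ℂ ξ (T 1)).re - 2⁻¹ * (t ^ 2 * (inner ℂ ξ (T (x * x))).re)
        - (inner ℂ ξ (T s)).re := by
    have : (2⁻¹ : ℂ) = ((2⁻¹ : ℝ) : ℂ) := by simp
    rw [map_sub, map_sub, map_smul, map_smul, inner_sub_right, inner_sub_right, inner_smul_right,
      inner_smul_right, this, Complex.sub_re, Complex.sub_re, Complex.re_ofReal_mul,
      Complex.re_ofReal_mul]
  rw [h3] at h2
  rw [map_smul, norm_smul, Complex.norm_real, Real.norm_eq_abs, abs_of_pos ht, mul_pow] at h1
  have h4 := hle s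
  -- `M² - a² ≤ 2M(M - a)` for `a = ‖T s‖`
  have h5 : t ^ 2 * ‖T x‖ ^ 2 ≤ 2 * M * (M - ‖T s‖) := by nlinarith [sq_nonneg (M - ‖T s‖)]
  have h6 : t ^ 2 * ‖T x‖ ^ 2 ≤ 2 * M * (δ + 2⁻¹ * (t ^ 2 * (inner ℂ ξ (T (x * x))).re)
      + M * (t * ‖x‖) ^ 4) :=
    h5.trans (mul_le_mul_of_nonneg_left (by linarith) (by positivity))
  have ht2 : 0 < t ^ 2 := by positivity
  refine le_of_mul_le_mul_left (h6.trans_eq ?_) ht2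
  field_simp
  ring

/-- The square estimate, up to an error of order `δ / t² + t²`, for self-adjoint elements. -/
theorem sum_norm_sq_map_le (T : E →ₗ[ℂ] H) {M : ℝ} (hT : ∀ v ∈ unitary E, ‖T v‖ ≤ M) {δ : ℝ}
    (hδ : M - δ ≤ ‖T 1‖) {ι : Type*} [Fintype ι] {x : ι → E} (hx : ∀ i, IsSelfAdjoint (x i))
    {D : ℝ} (hD : ∀ i, ‖x i‖ ≤ D) {t : ℝ} (ht : 0 < t) (htx : t * D ≤ 1) :
    ∑ i, ‖T (x i)‖ ^ 2 ≤ M ^ 2 * ‖∑ i, x i * x i‖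
      + Fintype.card ι * (2 * M * (δ / t ^ 2 + M * t ^ 2 * D ^ 4)) := by
  have hM : 0 ≤ M := (norm_nonneg _).trans (hT 1 (one_mem _))
  -- `ξ` is the unit vector in the direction of `T 1`, or `0` if `T 1 = 0`
  obtain ⟨ξ, hξ, hξ1⟩ : ∃ ξ : H, ‖ξ‖ ≤ 1 ∧ ‖T 1‖ = (inner ℂ ξ (T 1)).re := by
    rcases eq_or_ne (T 1) 0 with h | h
    · exact ⟨0, by simp, by simp [h]⟩
    · have hn : ‖T 1‖ ≠ 0 := norm_ne_zero_iff.2 h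
      refine ⟨((‖T 1‖⁻¹ : ℝ) : ℂ) • T 1, ?_, ?_⟩
      · rw [norm_smul, Complex.norm_real, norm_inv, norm_norm, inv_mul_cancel₀ hn]
      · rw [inner_smul_left, Complex.conj_ofReal, Complex.re_ofReal_mul]
        have := inner_self_eq_norm_sq (𝕜 := ℂ) (T 1)
        rw [← RCLike.re_to_complex, this]
        field_simp
  have hsum : ∑ i, (inner ℂ ξ (T (x i * x i))).re ≤ M * ‖∑ i, x i * x i‖ := by
    have hs : IsSelfAdjoint (∑ i, x i * x i) :=
      isSelfAdjoint_sum _ fun i _ => isSelfAdjoint_mul_self (hx i)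
    rw [← Complex.re_sum, ← inner_sum, ← map_sum]
    exact ((re_inner_le_norm (𝕜 := ℂ) ξ _).trans (mul_le_of_le_one_left (norm_nonneg _) hξ)).trans
      (norm_map_le_of_isSelfAdjoint T hT hs)
  calc ∑ i, ‖T (x i)‖ ^ 2
      ≤ ∑ i, (M * (inner ℂ ξ (T (x i * x i))).re
          + 2 * M * (δ / t ^ 2 + M * t ^ 2 * D ^ 4)) := by
        refine Finset.sum_le_sum fun i _ => ?_
        refine (norm_sq_map_le T hT hξ (hξ1 ▸ hδ) (hx i) ht
          ((mul_le_mul_of_nonneg_left (hD i) ht.le).trans htx)).trans ?_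
        gcongr
        exact hD i
    _ = M * ∑ i, (inner ℂ ξ (T (x i * x i))).re
          + Fintype.card ι * (2 * M * (δ / t ^ 2 + M * t ^ 2 * D ^ 4)) := by
        rw [Finset.sum_add_distrib, ← Finset.mul_sum, Finset.sum_const, Finset.card_univ,
          nsmul_eq_mul]
    _ ≤ _ := by
        gcongr ?_ + _
        exact (mul_le_mul_of_nonneg_left hsum hM).trans_eq (by ring)

end Unital

/-! ### Haagerup's and Pisier's estimates for columns and rows -/

section ColumnBound

variable {A : Type*} [NonUnitalCStarAlgebra A]
  {H : Type*} [NormedAddCommGroup H] [InnerProductSpace ℂ H]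

/-- The map `b ↦ b * e` from the unitization of `A` to `A`, which is an ideal in it. -/
def mulInr (e : A) : Unitization ℂ A →ₗ[ℂ] A where
  toFun b := b.fst • e + b.snd * e
  map_add' b c := by
    simp only [Unitization.fst_add, Unitization.snd_add, add_smul, add_mul]; abel
  map_smul' c b := by
    simp only [Unitization.fst_smul, Unitization.snd_smul, smul_add, smul_mul_assoc, smul_assoc,
      RingHom.id_apply]

theorem inr_mulInr (e : A) (b : Unitization ℂ A) :
    (mulInr e b : Unitization ℂ A) = b * (e : Unitization ℂ A) := by
  ext <;> simp [mulInr]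

theorem mulInr_mul (e : A) (b c : Unitization ℂ A) :
    mulInr e (b * c) = mulInr (mulInr e c) b := by
  refine Unitization.inr_injective (R := ℂ) ?_
  simp only [inr_mulInr, mul_assoc]

theorem mulInr_inr (e z : A) : mulInr e (z : Unitization ℂ A) = z * e := by
  simp [mulInr]

theorem norm_mulInr_le (e : A) (b : Unitization ℂ A) : ‖mulInr e b‖ ≤ ‖b‖ * ‖e‖ := by
  rw [← Unitization.norm_inr (𝕜 := ℂ), inr_mulInr, ← Unitization.norm_inr (𝕜 := ℂ) (a := e)]
  exact norm_mul_le _ _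

/-- The linear map `b ↦ u (b * e) h` on the unitization of `A`. It stands in for `b ↦ u b h`: the
algebra `A` may lack unitaries, and the unital extension of `u` may have larger norm than `u`. -/
def evalMulInr (u : A →ₙₐ[ℂ] (H →L[ℂ] H)) (e : A) (h : H) : Unitization ℂ A →ₗ[ℂ] H where
  toFun b := u (mulInr e b) h
  map_add' b c := by simp
  map_smul' c b := by simp

/-- A contraction `w` of `A` can be split off on the left at the cost of a factor `K`. -/
theorem norm_evalMulInr_inr_mul_le {u : A →ₙₐ[ℂ] (H →L[ℂ] H)} {K : ℝ}
    (hu : ∀ a, ‖u a‖ ≤ K * ‖a‖) (e : A) (h : H) {w : Unitization ℂ A} (hw0 : w.fst = 0)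
    (hw : ‖w‖ ≤ 1) (hK : 0 ≤ K) (x : Unitization ℂ A) :
    ‖evalMulInr u e h (w * x)‖ ≤ K * ‖evalMulInr u e h x‖ := by
  have hwz : w = (w.snd : Unitization ℂ A) := by ext <;> simp [hw0]
  have h1 : evalMulInr u e h (w * x) = u w.snd (evalMulInr u e h x) := by
    change u (mulInr e (w * x)) h = u w.snd (u (mulInr e x) h)
    rw [mulInr_mul, hwz, mulInr_inr, map_mul]
    simp
  rw [h1]
  refine ((u w.snd).le_opNorm _).trans ?_
  gcongr
  refine (hu _).trans (mul_le_of_le_one_right hK ?_)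
  rwa [hwz, Unitization.norm_inr] at hw

/-- The column estimate with all entries multiplied on the right by a fixed contraction, which an
approximate unit removes afterwards. With `M` the supremum of `‖u (v * e) h‖` over the unitaries
`v`, one factor `K ^ 2` comes from `M ≤ K * ‖h‖` and another from the polar decomposition. -/
theorem sum_norm_sq_map_mul_le {u : A →ₙₐ[ℂ] (H →L[ℂ] H)} {K : ℝ} (hK : 0 ≤ K)
    (hu : ∀ a, ‖u a‖ ≤ K * ‖a‖) {ι : Type*} [Fintype ι] (a : ι → A) {e : A} (he : ‖e‖ ≤ 1)
    (h : H) :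
    ∑ i, ‖u (a i * e) h‖ ^ 2 ≤ K ^ 4 * ‖∑ i, star (a i) * a i‖ * ‖h‖ ^ 2 := by
  let V : Set ℝ := (fun v : Unitization ℂ A => ‖evalMulInr u e h v‖) '' unitary (Unitization ℂ A)
  have hVle : ∀ r ∈ V, r ≤ K * ‖h‖ := by
    rintro _ ⟨v, hv, rfl⟩
    refine ((u (mulInr e v)).le_opNorm h).trans ?_
    gcongr
    refine (hu _).trans (mul_le_of_le_one_right hK ((norm_mulInr_le e v).trans ?_))
    rw [CStarRing.norm_of_mem_unitary hv, one_mul]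
    exact he
  have hVbdd : BddAbove V := ⟨_, hVle⟩
  have hVne : V.Nonempty := ⟨_, 1, one_mem _, rfl⟩
  obtain ⟨M, hMdef⟩ : ∃ M, M = sSup V := ⟨_, rfl⟩
  have hMle : M ≤ K * ‖h‖ := hMdef ▸ csSup_le hVne hVle
  have hM : ∀ v ∈ unitary (Unitization ℂ A), ‖evalMulInr u e h v‖ ≤ M := fun v hv =>
    hMdef ▸ le_csSup hVbdd ⟨v, hv, rfl⟩
  have hM0 : 0 ≤ M := (norm_nonneg _).trans (hM 1 (one_mem _))
  let S := ‖∑ i, star (a i) * a i‖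
  let N : ℝ := Fintype.card ι
  let D : ℝ := ∑ i, ‖a i‖ + 1
  have hD1 : 1 ≤ D := le_add_of_nonneg_left (Finset.sum_nonneg fun i _ => norm_nonneg _)
  have key : ∀ t : ℝ, 0 < t → t * D ≤ 1 → ∑ i, ‖u (a i * e) h‖ ^ 2 ≤
      K ^ 2 * (M ^ 2 * (S + N * t ^ 2) + N * (2 * M * (t ^ 4 / t ^ 2 + M * t ^ 2 * D ^ 4))) := by
    intro t ht htD
    have ht1 : t ≤ 1 := by nlinarith
    -- the unitary `v` nearly attains the supremum; the error `t ^ 4` is negligible against `t ^ 2`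
    obtain ⟨_, ⟨v, hv, rfl⟩, hvM⟩ := exists_lt_of_lt_csSup hVne
      (hMdef ▸ sub_lt_self M (by positivity : 0 < t ^ 4))
    have hvv : star v * v = 1 := (Unitary.mem_iff.1 hv).1
    obtain ⟨T, hTdef⟩ : ∃ T, T = evalMulInr u (mulInr e v) h := ⟨_, rfl⟩
    have hTv : ∀ b, T b = evalMulInr u e h (b * v) := fun b => by
      rw [hTdef]; change u _ h = u _ h; rw [mulInr_mul]
    have hT : ∀ w ∈ unitary (Unitization ℂ A), ‖T w‖ ≤ M := fun w hw => by
      rw [hTv]; exact hM _ (mul_mem hw hv)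
    have hT1 : M - t ^ 4 ≤ ‖T 1‖ := by rw [hTv, one_mul, hMdef]; exact hvM.le
    choose x y hx hy hxy hxx using fun i =>
      exists_mul_eq_sq_eq ((a i : Unitization ℂ A) * star v) (pow_pos ht 2)
    have hTa : ∀ i, ‖u (a i * e) h‖ ≤ K * ‖T (x i)‖ := fun i => by
      have h1 : u (a i * e) h = T ((a i : Unitization ℂ A) * star v) := by
        rw [hTv, mul_assoc, hvv, mul_one, ← mulInr_inr]; rfl
      rw [h1, ← hxy i, hTdef]
      exact norm_evalMulInr_inr_mul_le hu _ h (by simp) (hy i) hK _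
    have hnv : ‖star v‖ ≤ 1 := by
      rw [norm_star, CStarRing.norm_of_mem_unitary hv]
    have hxD : ∀ i, ‖x i‖ ≤ D := fun i => by
      have h1 : ‖x i‖ ^ 2 ≤ ‖a i‖ ^ 2 + t ^ 2 := by
        rw [sq, ← CStarRing.norm_star_mul_self, (hx i).star_eq, hxx i]
        refine (norm_add_le _ _).trans (add_le_add ?_ ?_)
        · rw [CStarRing.norm_star_mul_self, ← sq]
          gcongr
          exact (norm_mul_le _ _).trans (mul_le_of_le_one_right (norm_nonneg _) hnv) |>.trans_eq
            (Unitization.norm_inr _)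
        · rw [norm_smul, norm_one, mul_one, Complex.norm_real, Real.norm_of_nonneg (by positivity)]
      have h2 : ‖a i‖ ≤ ∑ i, ‖a i‖ :=
        Finset.single_le_sum (f := fun i => ‖a i‖) (fun i _ => norm_nonneg _) (Finset.mem_univ i)
      refine (le_of_sq_le_sq (b := ‖a i‖ + 1) ?_ (by positivity)).trans (by simpa [D] using h2)
      nlinarith [norm_nonneg (a i)]
    have hsum : ‖∑ i, x i * x i‖ ≤ S + N * t ^ 2 := by
      have h1 : ∑ i, x i * x i = v * ((∑ i, star (a i) * a i : A) : Unitization ℂ A) * star v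
          + (N : ℂ) • (((t ^ 2 : ℝ) : ℂ) • 1) := by
        have h2 : ((∑ i, star (a i) * a i : A) : Unitization ℂ A)
            = ∑ i, star (a i : Unitization ℂ A) * (a i : Unitization ℂ A) := by
          refine (map_sum (Unitization.inrNonUnitalAlgHom ℂ A) _ _).trans ?_
          simp
        rw [Finset.sum_congr rfl fun i _ => hxx i, Finset.sum_add_distrib, Finset.sum_const,
          Finset.card_univ, h2, Finset.mul_sum, Finset.sum_mul]
        congr 1
        · exact Finset.sum_congr rfl fun i _ => by rw [star_mul, star_star]; noncomm_ring
        · simp [N, Nat.cast_smul_eq_nsmul]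
      rw [h1]
      refine (norm_add_le _ _).trans (add_le_add ?_ ?_)
      · refine (norm_mul_le _ _).trans (mul_le_of_le_one_right (norm_nonneg _) hnv) |>.trans ?_
        refine (norm_mul_le _ _).trans ?_
        rw [CStarRing.norm_of_mem_unitary hv, one_mul, Unitization.norm_inr]
      · rw [norm_smul, norm_smul, norm_one, mul_one, Complex.norm_real, Complex.norm_real,
          Real.norm_of_nonneg (by positivity), Real.norm_of_nonneg (by positivity)]
    calc ∑ i, ‖u (a i * e) h‖ ^ 2 ≤ ∑ i, K ^ 2 * ‖T (x i)‖ ^ 2 :=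
          Finset.sum_le_sum fun i _ => by
            rw [← mul_pow]; exact pow_le_pow_left₀ (norm_nonneg _) (hTa i) 2
      _ = K ^ 2 * ∑ i, ‖T (x i)‖ ^ 2 := by rw [Finset.mul_sum]
      _ ≤ _ := by
        gcongr
        refine (sum_norm_sq_map_le T hT hT1 hx hxD ht htD).trans ?_
        gcongr
  have hlim : Filter.Tendsto (fun t : ℝ =>
      K ^ 2 * (M ^ 2 * (S + N * t ^ 2) + N * (2 * M * (t ^ 2 + M * t ^ 2 * D ^ 4))))
      (nhdsWithin 0 (Set.Ioi 0)) (nhds (K ^ 2 * (M ^ 2 * S))) := by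
    have : Continuous (fun t : ℝ =>
      K ^ 2 * (M ^ 2 * (S + N * t ^ 2) + N * (2 * M * (t ^ 2 + M * t ^ 2 * D ^ 4)))) := by fun_prop
    simpa using (this.tendsto 0).mono_left nhdsWithin_le_nhds
  have hfin : ∑ i, ‖u (a i * e) h‖ ^ 2 ≤ K ^ 2 * (M ^ 2 * S) := by
    refine ge_of_tendsto hlim ?_
    filter_upwards [Ioc_mem_nhdsGT (by positivity : (0 : ℝ) < D⁻¹)] with t ht
    refine (key t ht.1 ?_).trans_eq ?_
    · rw [← le_div_iff₀ (by positivity), one_div]; exact ht.2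
    · have := ht.1.ne'
      rw [show t ^ 4 / t ^ 2 = t ^ 2 by field_simp]
  calc _ ≤ K ^ 2 * (M ^ 2 * S) := hfin
    _ ≤ K ^ 2 * ((K * ‖h‖) ^ 2 * S) := by gcongr
    _ = _ := by ring

/-- The column estimate of Haagerup and Pisier. -/
theorem sum_norm_sq_map_apply_le {u : A →ₙₐ[ℂ] (H →L[ℂ] H)} {K : ℝ} (hK : 0 ≤ K)
    (hu : ∀ a, ‖u a‖ ≤ K * ‖a‖) {ι : Type*} [Fintype ι] (a : ι → A) (h : H) :
    ∑ i, ‖u (a i) h‖ ^ 2 ≤ K ^ 4 * ‖∑ i, star (a i) * a i‖ * ‖h‖ ^ 2 := by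
  let _ := CStarAlgebra.spectralOrder A
  have := CStarAlgebra.spectralOrderedRing A
  have hl := CStarAlgebra.increasingApproximateUnit A
  have hc : Continuous u := AddMonoidHomClass.continuous_of_bound u K hu
  have hlim : Filter.Tendsto (fun e => ∑ i, ‖u (a i * e) h‖ ^ 2) (CStarAlgebra.approximateUnit A)
      (nhds (∑ i, ‖u (a i) h‖ ^ 2)) := by
    refine tendsto_finsetSum _ fun i _ => ?_
    have hc2 : Continuous fun b => ‖u b h‖ ^ 2 := by fun_prop
    exact (hc2.tendsto (a i)).comp (hl.tendsto_mul_left (a i))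
  refine le_of_tendsto hlim ?_
  filter_upwards [hl.eventually_norm] with e he using sum_norm_sq_map_mul_le hK hu a he h

theorem norm_matOp_col_le {u : A →ₙₐ[ℂ] (H →L[ℂ] H)} {K : ℝ} (hK : 0 ≤ K)
    (hu : ∀ a, ‖u a‖ ≤ K * ‖a‖) {n : ℕ} (c : Fin n → A) :
    ‖matOp (Matrix.of fun i (_ : Fin 1) => u (c i))‖ ≤ K ^ 2 * √‖∑ i, star (c i) * c i‖ := by
  refine ContinuousLinearMap.opNorm_le_bound _ (by positivity) fun x => ?_
  refine le_of_sq_le_sq ?_ (by positivity)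
  have hx : ‖x‖ ^ 2 = ‖x 0‖ ^ 2 := by rw [PiLp.norm_sq_eq_of_L2]; simp
  rw [mul_pow, mul_pow, Real.sq_sqrt (norm_nonneg _), hx, PiLp.norm_sq_eq_of_L2]
  simp only [matOp_apply, Finset.univ_unique, Finset.sum_singleton, Matrix.of_apply]
  exact (sum_norm_sq_map_apply_le hK hu c (x 0)).trans_eq (by ring)

variable [CompleteSpace H]

/-- The homomorphism `a ↦ (u (a⋆))⋆`, which has the same norm as `u`. -/
def adjointHom (u : A →ₙₐ[ℂ] (H →L[ℂ] H)) : A →ₙₐ[ℂ] (H →L[ℂ] H) where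
  toFun a := star (u (star a))
  map_smul' c a := by simp
  map_zero' := by simp
  map_add' a b := by simp
  map_mul' a b := by simp

/-- The row estimate, dual to the column estimate for `adjointHom u`. -/
theorem norm_sum_map_apply_sq_le {u : A →ₙₐ[ℂ] (H →L[ℂ] H)} {K : ℝ} (hK : 0 ≤ K)
    (hu : ∀ a, ‖u a‖ ≤ K * ‖a‖) {ι : Type*} [Fintype ι] (a : ι → A) (h : ι → H) :
    ‖∑ i, u (a i) (h i)‖ ^ 2 ≤ K ^ 4 * ‖∑ i, a i * star (a i)‖ * ∑ i, ‖h i‖ ^ 2 := by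
  obtain ⟨k, hk⟩ : ∃ k, k = ∑ i, u (a i) (h i) := ⟨_, rfl⟩
  have h1 := sum_norm_sq_map_apply_le (u := adjointHom u) hK
    (fun a => by simpa [adjointHom] using hu (star a)) (fun i => star (a i)) k
  simp only [star_star] at h1
  have h2 : ∀ i, adjointHom u (star (a i)) k = star (u (a i)) k := fun i => by
    simp [adjointHom]
  simp only [h2] at h1
  rw [← hk]
  have h3 : ‖k‖ ^ 2 ≤ ∑ i, ‖star (u (a i)) k‖ * ‖h i‖ := by
    rw [← inner_self_eq_norm_sq (𝕜 := ℂ)]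
    conv_lhs => enter [2, 2]; rw [hk]
    rw [sum_inner, map_sum]
    refine Finset.sum_le_sum fun i _ => ?_
    rw [← ContinuousLinearMap.adjoint_inner_right, mul_comm]
    exact re_inner_le_norm _ _
  have h4 := Finset.sum_mul_sq_le_sq_mul_sq Finset.univ (fun i => ‖star (u (a i)) k‖)
    (fun i => ‖h i‖)
  have h5 : (‖k‖ ^ 2) ^ 2 ≤ (K ^ 4 * ‖∑ i, a i * star (a i)‖ * ∑ i, ‖h i‖ ^ 2) * ‖k‖ ^ 2 :=
    calc (‖k‖ ^ 2) ^ 2 ≤ (∑ i, ‖star (u (a i)) k‖ * ‖h i‖) ^ 2 := by gcongr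
      _ ≤ _ := h4
      _ ≤ (K ^ 4 * ‖∑ i, a i * star (a i)‖ * ‖k‖ ^ 2) * ∑ i, ‖h i‖ ^ 2 := by gcongr
      _ = _ := by ring
  rcases (sq_nonneg ‖k‖).eq_or_lt with h0 | h0
  · rw [← h0]; positivity
  · rw [sq (‖k‖ ^ 2)] at h5
    exact le_of_mul_le_mul_right h5 h0

theorem norm_matOp_row_le {u : A →ₙₐ[ℂ] (H →L[ℂ] H)} {K : ℝ} (hK : 0 ≤ K)
    (hu : ∀ a, ‖u a‖ ≤ K * ‖a‖) {n : ℕ} (r : Fin n → A) :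
    ‖matOp (Matrix.of fun (_ : Fin 1) j => u (r j))‖ ≤ K ^ 2 * √‖∑ j, r j * star (r j)‖ := by
  refine ContinuousLinearMap.opNorm_le_bound _ (by positivity) fun x => ?_
  refine le_of_sq_le_sq ?_ (by positivity)
  rw [mul_pow, mul_pow, Real.sq_sqrt (norm_nonneg _), PiLp.norm_sq_eq_of_L2,
    PiLp.norm_sq_eq_of_L2]
  simp only [matOp_apply, Finset.univ_unique, Finset.sum_singleton, Matrix.of_apply]
  exact (norm_sum_map_apply_sq_le hK hu r x).trans_eq (by ring)

end ColumnBound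

/-! ### Norms of operator matrices and of C⋆-matrices -/

section OpENorm

variable {E F : Type*} [SeminormedAddCommGroup E] [Module ℂ E] [SeminormedAddCommGroup F]
  [Module ℂ F]

/-- The homogeneity of the norms and their definiteness at `x` are hypotheses rather than instances,
since `opENorm` only asks for a module structure and a seminorm. -/
theorem norm_map_le_opENorm_toReal_mul (hE : ∀ (c : ℂ) (x : E), ‖c • x‖ = ‖c‖ * ‖x‖)
    (hF : ∀ (c : ℂ) (y : F), ‖c • y‖ = ‖c‖ * ‖y‖) {f : E →ₗ[ℂ] F}
    (hf : opENorm f < ∞) {x : E} (hx : ‖x‖ = 0 → x = 0) : ‖f x‖ ≤ (opENorm f).toReal * ‖x‖ := by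
  rcases (norm_nonneg x).eq_or_lt with h0 | hn
  · rw [hx h0.symm, map_zero, norm_zero, norm_zero, mul_zero]
  have h1 : ‖f (((‖x‖⁻¹ : ℝ) : ℂ) • x)‖ₑ ≤ opENorm f := by
    refine le_iSup₂ (f := fun (x : E) (_ : ‖x‖ ≤ 1) => ‖f x‖ₑ) (((‖x‖⁻¹ : ℝ) : ℂ) • x) ?_
    rw [hE, Complex.norm_real, norm_inv, norm_norm, inv_mul_cancel₀ hn.ne']
  have h2 := ENNReal.toReal_mono hf.ne h1
  rw [toReal_enorm, map_smul, hF, Complex.norm_real, norm_inv, norm_norm,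
    inv_mul_le_iff₀ hn] at h2
  rwa [mul_comm]

theorem opENorm_le_ofReal {f : E →ₗ[ℂ] F} {C : ℝ} (hC : 0 ≤ C) (hf : ∀ x, ‖f x‖ ≤ C * ‖x‖) :
    opENorm f ≤ ENNReal.ofReal C := by
  refine iSup₂_le fun x hx => ?_
  rw [← ofReal_norm]
  exact ENNReal.ofReal_le_ofReal ((hf x).trans (mul_le_of_le_one_right hC hx))

end OpENorm

section MatrixNorms

variable {H : Type*} [NormedAddCommGroup H] [InnerProductSpace ℂ H]

theorem matOp_mul {l m n : ℕ} (X : Matrix (Fin l) (Fin m) (H →L[ℂ] H))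
    (Y : Matrix (Fin m) (Fin n) (H →L[ℂ] H)) : matOp (X * Y) = matOp X ∘L matOp Y := by
  ext x i
  simp only [matOp_apply, ContinuousLinearMap.comp_apply, Matrix.mul_apply, map_sum,
    sum_apply, mul_apply_eq_comp]
  exact Finset.sum_comm

theorem matOp_smul {m n : ℕ} (c : ℂ) (X : Matrix (Fin m) (Fin n) (H →L[ℂ] H)) :
    matOp (c • X) = c • matOp X := by
  ext x i
  simp [matOp_apply, Finset.smul_sum]

set_option maxSynthPendingDepth 3 in
theorem norm_matOp_smul {m n : ℕ} (c : ℂ) (X : Matrix (Fin m) (Fin n) (H →L[ℂ] H)) :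
    ‖matOp (c • X)‖ = ‖c‖ * ‖matOp X‖ := by
  rw [matOp_smul, norm_smul]

theorem norm_matOp_one_one (X : Matrix (Fin 1) (Fin 1) (H →L[ℂ] H)) : ‖matOp X‖ = ‖X 0 0‖ := by
  have hn : ∀ x : PiLp 2 (fun _ : Fin 1 => H), ‖x‖ = ‖x 0‖ := fun x => by
    rw [PiLp.norm_eq_of_L2]; simp
  refine le_antisymm (ContinuousLinearMap.opNorm_le_bound _ (norm_nonneg _) fun x => ?_)
    (ContinuousLinearMap.opNorm_le_bound _ (matOp X).opNorm_nonneg fun x => ?_)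
  · rw [hn, hn x, matOp_apply]
    simpa using (X 0 0).le_opNorm (x 0)
  · have := (matOp X).le_opNorm (WithLp.toLp 2 fun _ => x)
    rw [hn, hn (WithLp.toLp 2 fun _ => x), matOp_apply] at this
    simpa using this

variable {B : NonUnitalSubalgebra ℂ (H →L[ℂ] H)}

theorem map_coe_mul {l m n : ℕ} (X : Matrix (Fin l) (Fin m) B) (Y : Matrix (Fin m) (Fin n) B) :
    (X * Y).map (fun b => (b : H →L[ℂ] H)) =
      X.map (fun b => (b : H →L[ℂ] H)) * Y.map (fun b => (b : H →L[ℂ] H)) := by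
  ext i j : 2
  simp [Matrix.mul_apply]

set_option maxSynthPendingDepth 3 in
theorem matENorm_eq_ofReal_norm {m n : ℕ} (X : Matrix (Fin m) (Fin n) B) :
    matENorm X = ENNReal.ofReal ‖matOp (X.map fun b => (b : H →L[ℂ] H))‖ := by
  rw [matENorm, ofReal_norm]

theorem matENorm_mul_le {l m n : ℕ} (X : Matrix (Fin l) (Fin m) B) (Y : Matrix (Fin m) (Fin n) B) :
    matENorm (X * Y) ≤ matENorm X * matENorm Y := by
  simp only [matENorm, map_coe_mul, matOp_mul]
  exact ContinuousLinearMap.opENorm_comp_le _ _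

theorem matENorm_smul {m n : ℕ} (c : ℂ) (X : Matrix (Fin m) (Fin n) B) :
    matENorm (c • X) = ‖c‖ₑ * matENorm X := by
  have : (c • X).map (fun b => (b : H →L[ℂ] H)) = c • X.map (fun b => (b : H →L[ℂ] H)) := by
    ext i j : 2
    simp
  rw [matENorm_eq_ofReal_norm, matENorm_eq_ofReal_norm, this, norm_matOp_smul,
    ENNReal.ofReal_mul (norm_nonneg _), ofReal_norm]

theorem matENorm_ne_top {m n : ℕ} (X : Matrix (Fin m) (Fin n) B) : matENorm X ≠ ∞ := by
  simp [matENorm]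

theorem eta_le_matENorm {n : ℕ} (X : Matrix (Fin n) (Fin n) B) : eta X ≤ matENorm X := by
  refine iSup₂_le fun R C => iSup₂_le fun hR hC => ?_
  calc matENorm (R * X * C) ≤ matENorm R * matENorm X * matENorm C :=
        (matENorm_mul_le _ _).trans (by gcongr; exact matENorm_mul_le _ _)
    _ ≤ 1 * matENorm X * 1 := by gcongr
    _ = matENorm X := by rw [one_mul, mul_one]

/-- Rows and columns of arbitrary norm in the supremum that defines `eta`. If `α` or `β` is not
positive, then `ENNReal.ofReal` truncates it and both sides vanish. -/
theorem matENorm_mul_mul_le_eta {n : ℕ} (X : Matrix (Fin n) (Fin n) B)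
    (R : Matrix (Fin 1) (Fin n) B) (C : Matrix (Fin n) (Fin 1) B) {α β : ℝ}
    (hR : matENorm R ≤ ENNReal.ofReal α) (hC : matENorm C ≤ ENNReal.ofReal β) :
    matENorm (R * X * C) ≤ ENNReal.ofReal α * ENNReal.ofReal β * eta X := by
  have hmul : matENorm (R * X * C) ≤ matENorm R * matENorm X * matENorm C :=
    (matENorm_mul_le _ _).trans (by gcongr; exact matENorm_mul_le _ _)
  rcases le_or_gt α 0 with hα | hα
  · rw [ENNReal.ofReal_of_nonpos hα, nonpos_iff_eq_zero] at hR
    exact hmul.trans (by simp [hR])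
  rcases le_or_gt β 0 with hβ | hβ
  · rw [ENNReal.ofReal_of_nonpos hβ, nonpos_iff_eq_zero] at hC
    exact hmul.trans (by simp [hC])
  have hen : ∀ {γ : ℝ}, 0 < γ → ‖((γ⁻¹ : ℝ) : ℂ)‖ₑ = (ENNReal.ofReal γ)⁻¹ := fun {γ} hγ => by
    rw [← ofReal_norm, Complex.norm_real, Real.norm_of_nonneg (by positivity),
      ENNReal.ofReal_inv_of_pos hγ]
  have hα0 : ENNReal.ofReal α ≠ 0 := by simpa using hα
  have hβ0 : ENNReal.ofReal β ≠ 0 := by simpa using hβ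
  have hle : ∀ {γ : ℝ} (_ : 0 < γ) {m k : ℕ} {Z : Matrix (Fin m) (Fin k) B},
      matENorm Z ≤ ENNReal.ofReal γ → matENorm (((γ⁻¹ : ℝ) : ℂ) • Z) ≤ 1 := by
    intro γ hγ m k Z hZ
    rw [matENorm_smul, hen hγ]
    exact (mul_le_mul_right hZ _).trans (ENNReal.inv_mul_le_one _)
  have h1 : matENorm ((((α⁻¹ : ℝ) : ℂ) • R) * X * (((β⁻¹ : ℝ) : ℂ) • C)) ≤ eta X :=
    le_iSup₂_of_le _ _ (le_iSup₂_of_le (hle hα hR) (hle hβ hC) le_rfl)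
  rw [Matrix.smul_mul, Matrix.smul_mul, Matrix.mul_smul, matENorm_smul, matENorm_smul, hen hα,
    hen hβ, ENNReal.inv_mul_le_iff hα0 ENNReal.ofReal_ne_top,
    ENNReal.inv_mul_le_iff hβ0 ENNReal.ofReal_ne_top] at h1
  exact h1.trans_eq (by ring)

end MatrixNorms

section CStarMatrix

open scoped InnerProductSpace

variable {A : Type*} [NonUnitalCStarAlgebra A] [PartialOrder A] [StarOrderedRing A]
  {n : ℕ}

/-- In Mathlib, `Y` acts on the right of the Hilbert C⋆-module of rows, so that `r Y c` is the inner
product of `c⋆` with the image of `r`. -/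
theorem norm_row_mul_mul_col_le (Y : CStarMatrix (Fin n) (Fin n) A) (r c : Fin n → A) :
    ‖∑ j, (∑ i, r i * Y i j) * c j‖ ≤
      ‖Y‖ * √‖∑ i, r i * star (r i)‖ * √‖∑ i, star (c i) * c i‖ := by
  let v := (WithCStarModule.equiv A (Fin n → A)).symm r
  let w := (WithCStarModule.equiv A (Fin n → A)).symm fun i => star (c i)
  have hv : ‖v‖ = √‖∑ i, r i * star (r i)‖ := WithCStarModule.pi_norm v
  have hw : ‖w‖ = √‖∑ i, star (c i) * c i‖ := by
    refine (WithCStarModule.pi_norm w).trans ?_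
    simp [w, WithCStarModule.inner_def]
  have h1 : ⟪w, CStarMatrix.toCLM Y v⟫_A = ∑ j, (∑ i, r i * Y i j) * c j := by
    simp [CStarMatrix.toCLM_apply_eq_sum, WithCStarModule.pi_inner, v, w,
      WithCStarModule.inner_def]
  rw [← h1, ← hv, ← hw]
  refine (CStarModule.norm_inner_le (WithCStarModule A (Fin n → A))).trans ?_
  rw [mul_comm]
  gcongr
  exact (CStarMatrix.toCLM Y).le_opNorm v

theorem norm_le_of_forall_row_mul_mul_col {Y : CStarMatrix (Fin n) (Fin n) A} {C : ℝ} (hC : 0 ≤ C)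
    (h : ∀ r c : Fin n → A, ‖∑ j, (∑ i, r i * Y i j) * c j‖ ≤
      C * √‖∑ i, r i * star (r i)‖ * √‖∑ i, star (c i) * c i‖) : ‖Y‖ ≤ C := by
  lift C to NNReal using hC
  refine CStarMatrix.norm_le_of_forall_inner_le fun v w => ?_
  have h1 := h v fun i => star (w i)
  have h2 : ⟪w, CStarMatrix.toCLM Y v⟫_A = ∑ j, (∑ i, v i * Y i j) * star (w j) := by
    simp [CStarMatrix.toCLM_apply_eq_sum, WithCStarModule.pi_inner, WithCStarModule.inner_def]
  rw [h2, WithCStarModule.pi_norm v, WithCStarModule.pi_norm w]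
  simpa [WithCStarModule.inner_def] using h1

end CStarMatrix

/-! ### Comparison of the norms on the quotient and on the image -/

section Lift

variable {A Q : Type*} [NonUnitalCStarAlgebra A] [PartialOrder A] [StarOrderedRing A]
  [NonUnitalCStarAlgebra Q] [PartialOrder Q] [StarOrderedRing Q]

/-- Norms of lifts along a homomorphism of C⋆-algebras; with `q` on entries, for matrices. -/
theorem exists_map_eq_norm_le {A Q : Type*} [NonUnitalCStarAlgebra A] [NonUnitalCStarAlgebra Q]
    (φ : A →⋆ₙₐ[ℂ] Q) (a₀ : A) {s : ℝ} (hs : ‖φ a₀‖ < s) : ∃ a, φ a = φ a₀ ∧ ‖a‖ ≤ s := by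
  have hφ : ∀ a, ‖φ a‖ ≤ 1 * ‖a‖ := fun a => by
    rw [one_mul]; exact NonUnitalStarAlgHom.norm_apply_le φ a
  obtain ⟨a, ha, hle⟩ := exists_eq_norm_sq_le (φ : A →ₙ+* Q) hφ a₀ (r := s ^ 2) (by
    change ‖φ (star a₀ * a₀)‖ < s ^ 2
    rw [map_mul, map_star, CStarRing.norm_star_mul_self, ← sq]
    exact pow_lt_pow_left₀ hs (norm_nonneg _) two_ne_zero)
  exact ⟨a, ha, le_of_sq_le_sq hle ((norm_nonneg _).trans hs.le)⟩

theorem exists_matrix_lift_norm_le (q : A →⋆ₙₐ[ℂ] Q) (hq : Function.Surjective q) {n : ℕ}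
    (Y : CStarMatrix (Fin n) (Fin n) Q) {s : ℝ} (hs : ‖Y‖ < s) :
    ∃ T : CStarMatrix (Fin n) (Fin n) A, (∀ i j, q (T i j) = Y i j) ∧ ‖T‖ ≤ s := by
  choose a ha using fun i j => hq (Y i j)
  have hT₀ : CStarMatrix.mapₙₐ (n := Fin n) q (CStarMatrix.ofMatrix (Matrix.of a)) = Y :=
    CStarMatrix.ext ha
  obtain ⟨T, hT, hle⟩ := exists_map_eq_norm_le (CStarMatrix.mapₙₐ (n := Fin n) q) _ (hT₀ ▸ hs)
  refine ⟨T, fun i j => ?_, hle⟩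
  rw [← hT.trans hT₀]
  rfl

end Lift

section Injective

variable {Q : Type*} [NonUnitalCStarAlgebra Q]
  {H : Type*} [NormedAddCommGroup H] [InnerProductSpace ℂ H]
  {v : Q →ₙₐ[ℂ] (H →L[ℂ] H)} {K κ : ℝ}

theorem norm_matOp_nonneg {m n : ℕ} (X : Matrix (Fin m) (Fin n) (H →L[ℂ] H)) : 0 ≤ ‖matOp X‖ :=
  (matOp X).opNorm_nonneg

theorem norm_map_sum_mul_le (v : Q →ₙₐ[ℂ] (H →L[ℂ] H)) {n : ℕ} (r c : Fin n → Q) :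
    ‖v (∑ i, r i * c i)‖ ≤ ‖matOp (Matrix.of fun (_ : Fin 1) j => v (r j))‖ *
      ‖matOp (Matrix.of fun i (_ : Fin 1) => v (c i))‖ := by
  refine le_trans (le_of_eq ?_) (ContinuousLinearMap.opNorm_comp_le _ _)
  rw [← matOp_mul, norm_matOp_one_one]
  simp [Matrix.mul_apply]

theorem sqrt_le_of_sq_le {s C : ℝ} (hs : 0 ≤ s) (hC : 0 ≤ C) (h : s ≤ C * √s) : √s ≤ C := by
  rcases hs.eq_or_lt with rfl | h0
  · simpa using hC
  · refine le_of_mul_le_mul_right ?_ (Real.sqrt_pos.2 h0)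
    rwa [Real.mul_self_sqrt hs]

/-- A column whose image has norm at most one: the row estimate for `star c` bounds the image of
`star c * c` by a multiple of the norm of `c`, not of its square. -/
theorem sqrt_norm_col_le (hK : 0 ≤ K) (hκ : 0 ≤ κ) [CompleteSpace H] (hv : ∀ x, ‖v x‖ ≤ K * ‖x‖)
    (hvκ : ∀ x, ‖x‖ ≤ κ * ‖v x‖) {n : ℕ} (c : Fin n → Q)
    (hc : ‖matOp (Matrix.of fun i (_ : Fin 1) => v (c i))‖ ≤ 1) :
    √‖∑ i, star (c i) * c i‖ ≤ κ * K ^ 2 := by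
  refine sqrt_le_of_sq_le (norm_nonneg _) (by positivity) ?_
  have h1 := norm_matOp_row_le hK hv fun i => star (c i)
  simp only [star_star] at h1
  calc _ ≤ κ * ‖v (∑ i, star (c i) * c i)‖ := hvκ _
    _ ≤ κ * (K ^ 2 * √‖∑ i, star (c i) * c i‖ * 1) :=
      mul_le_mul_of_nonneg_left ((norm_map_sum_mul_le v (fun i => star (c i)) c).trans
        (mul_le_mul h1 hc (norm_matOp_nonneg _) (by positivity))) hκ
    _ = _ := by ring

theorem sqrt_norm_row_le (hK : 0 ≤ K) (hκ : 0 ≤ κ) (hv : ∀ x, ‖v x‖ ≤ K * ‖x‖)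
    (hvκ : ∀ x, ‖x‖ ≤ κ * ‖v x‖) {n : ℕ} (r : Fin n → Q)
    (hr : ‖matOp (Matrix.of fun (_ : Fin 1) j => v (r j))‖ ≤ 1) :
    √‖∑ i, r i * star (r i)‖ ≤ κ * K ^ 2 := by
  refine sqrt_le_of_sq_le (norm_nonneg _) (by positivity) ?_
  have h1 := norm_matOp_col_le hK hv fun i => star (r i)
  simp only [star_star] at h1
  calc _ ≤ κ * ‖v (∑ i, r i * star (r i))‖ := hvκ _
    _ ≤ κ * (1 * (K ^ 2 * √‖∑ i, r i * star (r i)‖)) :=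
      mul_le_mul_of_nonneg_left ((norm_map_sum_mul_le v r fun i => star (r i)).trans
        (mul_le_mul hr h1 (norm_matOp_nonneg _) zero_le_one)) hκ
    _ = _ := by ring

variable {B : NonUnitalSubalgebra ℂ (H →L[ℂ] H)} {n : ℕ}

theorem matENorm_eq_ofReal (R : Matrix (Fin 1) (Fin n) B)
    (X : Matrix (Fin n) (Fin n) B) (C : Matrix (Fin n) (Fin 1) B) {r c : Fin n → Q}
    {Y : CStarMatrix (Fin n) (Fin n) Q} (hR : ∀ i, v (r i) = R 0 i) (hX : ∀ i j, v (Y i j) = X i j)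
    (hC : ∀ i, v (c i) = C i 0) :
    matENorm (R * X * C) = ENNReal.ofReal ‖v (∑ j, (∑ i, r i * Y i j) * c j)‖ := by
  rw [matENorm_eq_ofReal_norm, norm_matOp_one_one]
  congr 2
  simp [Matrix.mul_apply, hR, hX, hC]

variable [PartialOrder Q] [StarOrderedRing Q] [CompleteSpace H]

/-- The upper bound for `eta` at the image of a contraction `Y`. -/
theorem eta_le (hK : 0 ≤ K) (hκ : 0 ≤ κ) (hinj : Function.Injective v)
    (hv : ∀ x, ‖v x‖ ≤ K * ‖x‖) (hvκ : ∀ x, ‖x‖ ≤ κ * ‖v x‖)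
    (hB : ∀ b : B, ∃ x, v x = b) (X : Matrix (Fin n) (Fin n) B)
    {Y : CStarMatrix (Fin n) (Fin n) Q} (hX : ∀ i j, v (Y i j) = X i j) (hY : ‖Y‖ ≤ 1) :
    eta X ≤ ENNReal.ofReal (K ^ 9 * κ ^ 2) := by
  choose l hl using hB
  refine iSup₂_le fun R C => iSup₂_le fun hR hC => ?_
  let r : Fin n → Q := fun i => l (R 0 i)
  let c : Fin n → Q := fun i => l (C i 0)
  rw [matENorm_eq_ofReal (Y := Y) (r := r) (c := c) R X C (fun i => hl _) hX (fun i => hl _)]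
  refine ENNReal.ofReal_le_ofReal ?_
  obtain ⟨z, hz⟩ : ∃ z, z = ∑ j, (∑ i, r i * Y i j) * c j := ⟨_, rfl⟩
  rw [← hz]
  rcases eq_or_ne z 0 with h0 | h0
  · rw [h0, map_zero, norm_zero]; positivity
  have hK1 : 1 ≤ K := one_le_of_norm_map_le (v : Q →ₙ+* (H →L[ℂ] H)) hinj hv h0
  have hr : √‖∑ i, r i * star (r i)‖ ≤ κ * K ^ 2 := by
    refine sqrt_norm_row_le hK hκ hv hvκ r ?_
    have h1 : R.map (fun b => (b : H →L[ℂ] H)) = Matrix.of fun (_ : Fin 1) j => v (r j) := by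
      ext i j : 1
      rw [Subsingleton.elim i 0]
      exact (hl _).symm
    rw [matENorm_eq_ofReal_norm, h1] at hR
    simpa using hR
  have hc : √‖∑ i, star (c i) * c i‖ ≤ κ * K ^ 2 := by
    refine sqrt_norm_col_le hK hκ hv hvκ c ?_
    have h1 : C.map (fun b => (b : H →L[ℂ] H)) = Matrix.of fun i (_ : Fin 1) => v (c i) := by
      ext i j : 1
      rw [Subsingleton.elim j 0]
      exact (hl _).symm
    rw [matENorm_eq_ofReal_norm, h1] at hC
    simpa using hC
  calc ‖v z‖ ≤ K * ‖z‖ := hv z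
    _ ≤ K * (1 * (κ * K ^ 2) * (κ * K ^ 2)) := by
      rw [hz]
      gcongr
      refine (norm_row_mul_mul_col_le Y r c).trans ?_
      gcongr
    _ = K ^ 5 * κ ^ 2 := by ring
    _ ≤ K ^ 9 * κ ^ 2 := by
      gcongr
      norm_num

/-- The lower bound for `eta` at the image of a matrix `Y`. -/
theorem norm_le_mul_eta (hK : 0 ≤ K) (hκ : 0 ≤ κ)
    (hv : ∀ x, ‖v x‖ ≤ K * ‖x‖) (hvκ : ∀ x, ‖x‖ ≤ κ * ‖v x‖)
    (hB : ∀ x, v x ∈ B) (X : Matrix (Fin n) (Fin n) B)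
    {Y : CStarMatrix (Fin n) (Fin n) Q} (hX : ∀ i j, v (Y i j) = X i j) :
    ‖Y‖ ≤ κ * K ^ 4 * (eta X).toReal := by
  have hη : eta X ≠ ∞ := ne_top_of_le_ne_top (matENorm_ne_top X) (eta_le_matENorm X)
  refine norm_le_of_forall_row_mul_mul_col (by positivity) fun r c => ?_
  refine (hvκ _).trans ?_
  let R : Matrix (Fin 1) (Fin n) B := Matrix.of fun _ j => ⟨v (r j), hB _⟩
  let C : Matrix (Fin n) (Fin 1) B := Matrix.of fun i _ => ⟨v (c i), hB _⟩
  have hR : matENorm R ≤ ENNReal.ofReal (K ^ 2 * √‖∑ i, r i * star (r i)‖) := by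
    rw [matENorm_eq_ofReal_norm]
    exact ENNReal.ofReal_le_ofReal (norm_matOp_row_le hK hv r)
  have hC : matENorm C ≤ ENNReal.ofReal (K ^ 2 * √‖∑ i, star (c i) * c i‖) := by
    rw [matENorm_eq_ofReal_norm]
    exact ENNReal.ofReal_le_ofReal (norm_matOp_col_le hK hv c)
  have h1 := matENorm_mul_mul_le_eta X R C hR hC
  rw [matENorm_eq_ofReal (Y := Y) (r := r) (c := c) R X C (fun _ => rfl) hX (fun _ => rfl),
    ← ENNReal.ofReal_toReal hη, ← ENNReal.ofReal_mul (by positivity),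
    ← ENNReal.ofReal_mul (by positivity), ENNReal.ofReal_le_ofReal_iff (by positivity)] at h1
  exact (mul_le_mul_of_nonneg_left h1 hκ).trans_eq (by ring)

end Injective

section CompletelyBounded

variable {A : Type*} [NonUnitalCStarAlgebra A] [PartialOrder A] [StarOrderedRing A]
  {H : Type*} [NormedAddCommGroup H] [InnerProductSpace ℂ H]

theorem norm_matOp_map_le_cbENorm_toReal_mul {u : A →ₙₐ[ℂ] (H →L[ℂ] H)}
    (hu : IsCompletelyBounded u) {n : ℕ} (T : CStarMatrix (Fin n) (Fin n) A) :
    ‖matOp (Matrix.of fun i j => u (T i j))‖ ≤ (cbENorm u).toReal * ‖T‖ := by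
  have hsmul : ∀ c : ℂ, ‖matOp (Matrix.of fun i j => u ((c • T) i j))‖ =
      ‖c‖ * ‖matOp (Matrix.of fun i j => u (T i j))‖ := fun c => by
    rw [← norm_matOp_smul]
    congr 2
    ext i j : 2
    simp
  rcases eq_or_ne T 0 with rfl | hT
  · have := hsmul 0
    rw [zero_smul, norm_zero, zero_mul] at this
    rw [this, norm_zero, mul_zero]
  have hn : 0 < ‖T‖ := norm_pos_iff.2 hT
  have h1 : ‖matOp (Matrix.of fun i j => u ((((‖T‖⁻¹ : ℝ) : ℂ) • T) i j))‖ₑ ≤ cbENorm u := by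
    refine le_iSup_of_le n (le_iSup₂_of_le (((‖T‖⁻¹ : ℝ) : ℂ) • T) ?_ le_rfl)
    rw [norm_smul, Complex.norm_real, norm_inv, norm_norm, inv_mul_cancel₀ hn.ne']
  have h2 := ENNReal.toReal_mono hu.ne h1
  rw [toReal_enorm, hsmul, Complex.norm_real, norm_inv, norm_norm, inv_mul_le_iff₀ hn] at h2
  rwa [mul_comm]

end CompletelyBounded

section InducedEquiv

variable {A : Type*} [NonUnitalCStarAlgebra A]
  {H : Type*} [NormedAddCommGroup H] [InnerProductSpace ℂ H]
  {u : A →ₙₐ[ℂ] (H →L[ℂ] H)}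

/-- The quotient `A ⧸ ker u` in the definition of `inducedEquiv` is `KerQuotient hu`, norm
included. -/
theorem norm_inducedEquiv_symm (hu : Continuous u) {b : NonUnitalAlgHom.range u} {a : A}
    (hab : u a = b) : ‖(inducedEquiv u).symm b‖ = ‖KerQuotient.mk hu a‖ := by
  have : (inducedEquiv u).symm b = Submodule.Quotient.mk a := by
    rw [LinearEquiv.symm_apply_eq]
    exact Subtype.ext hab.symm
  rw [this]
  rfl

theorem norm_kerQuotient_le (hu : Continuous u) {K : ℝ} (hK : 0 ≤ K) (hKu : ∀ a, ‖u a‖ ≤ K * ‖a‖)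
    (x : KerQuotient hu) : ‖x‖ ≤ K * ‖KerQuotient.lift hu x‖ :=
  norm_le_mul_norm_map (KerQuotient.lift hu : KerQuotient hu →ₙ+* (H →L[ℂ] H))
    KerQuotient.lift_injective (KerQuotient.norm_lift_le hK hKu) x

set_option maxSynthPendingDepth 3 in
theorem inducedInvENorm_le_ofReal {C : ℝ} (hC : 0 ≤ C)
    (h : ∀ (a) (b : NonUnitalAlgHom.range u), u a = b → ‖(inducedEquiv u).symm b‖ ≤ C * ‖u a‖) :
    inducedInvENorm u ≤ ENNReal.ofReal C := by
  refine opENorm_le_ofReal (E := NonUnitalAlgHom.range u)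
    (F := A ⧸ LinearMap.ker (u : A →ₗ[ℂ] (H →L[ℂ] H))) hC fun b => ?_
  obtain ⟨a, ha⟩ := b.2
  have hab : u a = b := ha
  have := h a b hab
  rw [hab] at this
  exact this

set_option maxSynthPendingDepth 3 in
theorem norm_inducedEquiv_symm_le (hinv : inducedInvENorm u < ∞) (a : A) :
    ‖(inducedEquiv u).symm ⟨u a, ⟨a, rfl⟩⟩‖ ≤ (inducedInvENorm u).toReal * ‖u a‖ := by
  have := norm_map_le_opENorm_toReal_mul (E := NonUnitalAlgHom.range u)
    (F := A ⧸ LinearMap.ker (u : A →ₗ[ℂ] (H →L[ℂ] H)))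
    (fun c x => norm_smul c (x : H →L[ℂ] H)) (fun c y => norm_smul c y) hinv
    (x := ⟨u a, ⟨a, rfl⟩⟩) (fun h => norm_eq_zero.1 h)
  exact this

theorem inducedInvENorm_lt_top (hu : Continuous u) {K : ℝ} (hK : 0 ≤ K)
    (hKu : ∀ a, ‖u a‖ ≤ K * ‖a‖) : inducedInvENorm u < ∞ := by
  refine (inducedInvENorm_le_ofReal hK fun a b hab => ?_).trans_lt ENNReal.ofReal_lt_top
  rw [norm_inducedEquiv_symm hu hab, ← KerQuotient.lift_mk (hφ := hu)]
  exact norm_kerQuotient_le hu hK hKu (KerQuotient.mk hu a)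

theorem norm_le_inducedInvENorm_toReal_mul (hu : Continuous u) (hinv : inducedInvENorm u < ∞)
    (x : KerQuotient hu) : ‖x‖ ≤ (inducedInvENorm u).toReal * ‖KerQuotient.lift hu x‖ := by
  obtain ⟨a, rfl⟩ := KerQuotient.mk_surjective x
  rw [KerQuotient.lift_mk, ← norm_inducedEquiv_symm hu (b := ⟨u a, ⟨a, rfl⟩⟩) rfl]
  exact norm_inducedEquiv_symm_le hinv a

theorem norm_map_le_repENorm_toReal_mul (hu : repENorm u < ∞) (a : A) :
    ‖u a‖ ≤ (repENorm u).toReal * ‖a‖ :=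
  norm_map_le_opENorm_toReal_mul (E := A) (F := H →L[ℂ] H) (fun c x => norm_smul c x)
    (fun c y => norm_smul c y) hu (fun h => norm_eq_zero.1 h)

end InducedEquiv

end KadisonNorming

end

open KadisonNorming in
theorem theorem2p7 {A : Type*} [NonUnitalCStarAlgebra A] [PartialOrder A] [StarOrderedRing A]
    {H : Type*} [NormedAddCommGroup H] [InnerProductSpace ℂ H] [CompleteSpace H]
    (u : A →ₙₐ[ℂ] (H →L[ℂ] H)) (hu : KadisonNorming.repENorm u < ∞) :
    KadisonNorming.inducedInvENorm u < ∞ ∧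
    (∀ lam : ℝ, 0 < lam → KadisonNorming.NormsItself lam (NonUnitalAlgHom.range u) →
      KadisonNorming.IsCompletelyBounded u ∧
      KadisonNorming.cbENorm u ≤ (ENNReal.ofReal lam)⁻¹ * KadisonNorming.repENorm u ^ 9 *
        KadisonNorming.inducedInvENorm u ^ 2) ∧
    (KadisonNorming.IsCompletelyBounded u →
      ∀ lam : ℝ, 0 < lam →
        ENNReal.ofReal lam ≤ 1 / (KadisonNorming.cbENorm u * KadisonNorming.inducedInvENorm u *
          KadisonNorming.repENorm u ^ 4) →
        KadisonNorming.NormsItself lam (NonUnitalAlgHom.range u)) := by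
  obtain ⟨K, hKdef⟩ : ∃ K, K = (repENorm u).toReal := ⟨_, rfl⟩
  have hK : 0 ≤ K := hKdef ▸ ENNReal.toReal_nonneg
  have hKu : ∀ a, ‖u a‖ ≤ K * ‖a‖ := fun a => hKdef ▸ norm_map_le_repENorm_toReal_mul hu a
  have hK' : repENorm u = ENNReal.ofReal K := by rw [hKdef, ENNReal.ofReal_toReal hu.ne]
  have hc : Continuous u := AddMonoidHomClass.continuous_of_bound u K hKu
  let Q := KerQuotient hc
  -- the norm of `CStarMatrix` asks for an order; it is the spectral one
  let _ : PartialOrder Q := CStarAlgebra.spectralOrder Q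
  have : StarOrderedRing Q := CStarAlgebra.spectralOrderedRing Q
  let q : A →⋆ₙₐ[ℂ] Q := KerQuotient.mkStarHom hc
  let v : Q →ₙₐ[ℂ] (H →L[ℂ] H) := KerQuotient.lift hc
  have hq : Function.Surjective q := KerQuotient.mk_surjective
  have hvq : ∀ a, v (q a) = u a := KerQuotient.lift_mk
  have hv : ∀ x, ‖v x‖ ≤ K * ‖x‖ := KerQuotient.norm_lift_le hK hKu
  have hinj : Function.Injective v := KerQuotient.lift_injective
  have hinv : inducedInvENorm u < ∞ := inducedInvENorm_lt_top hc hK hKu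
  obtain ⟨κ, hκdef⟩ : ∃ κ, κ = (inducedInvENorm u).toReal := ⟨_, rfl⟩
  have hκ : 0 ≤ κ := hκdef ▸ ENNReal.toReal_nonneg
  have hκ' : inducedInvENorm u = ENNReal.ofReal κ := by rw [hκdef, ENNReal.ofReal_toReal hinv.ne]
  have hvκ : ∀ x, ‖x‖ ≤ κ * ‖v x‖ := hκdef ▸ norm_le_inducedInvENorm_toReal_mul hc hinv
  have hB : ∀ b : NonUnitalAlgHom.range u, ∃ x, v x = b := by
    rintro ⟨_, a, rfl⟩
    exact ⟨q a, hvq a⟩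
  refine ⟨hinv, fun lam hlam hnorm => ?_, fun hcb lam hlam hle n X => ?_⟩
  · have hlam0 : ENNReal.ofReal lam ≠ 0 := by simpa using hlam
    have hcb : cbENorm u ≤ (ENNReal.ofReal lam)⁻¹ * repENorm u ^ 9 * inducedInvENorm u ^ 2 := by
      refine iSup_le fun n => iSup₂_le fun T hT => ?_
      rw [mul_assoc, ← ENNReal.mul_le_iff_le_inv hlam0 ENNReal.ofReal_ne_top]
      let X : Matrix (Fin n) (Fin n) (NonUnitalAlgHom.range u) :=
        Matrix.of fun i j => ⟨u (T i j), ⟨T i j, rfl⟩⟩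
      refine (hnorm n X).trans ?_
      rw [hK', hκ', ← ENNReal.ofReal_pow hK, ← ENNReal.ofReal_pow hκ,
        ← ENNReal.ofReal_mul (by positivity)]
      exact eta_le hK hκ hinj hv hvκ hB X (Y := CStarMatrix.mapₙₐ (n := Fin n) q T)
        (fun i j => hvq (T i j)) ((NonUnitalStarAlgHom.norm_apply_le _ T).trans hT)
    refine ⟨hcb.trans_lt ?_, hcb⟩
    rw [hK', hκ', ← ENNReal.ofReal_inv_of_pos hlam, ← ENNReal.ofReal_pow hK,
      ← ENNReal.ofReal_pow hκ]
    exact ENNReal.mul_lt_top (ENNReal.mul_lt_top ENNReal.ofReal_lt_top ENNReal.ofReal_lt_top)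
      ENNReal.ofReal_lt_top
  · choose l hl using hB
    let Y : CStarMatrix (Fin n) (Fin n) Q := CStarMatrix.ofMatrix (Matrix.of fun i j => l (X i j))
    have hη : eta X ≠ ∞ := ne_top_of_le_ne_top (matENorm_ne_top X) (eta_le_matENorm X)
    have hX : ∀ i j, v (Y i j) = X i j := fun i j => hl _
    have hY : ‖Y‖ ≤ κ * K ^ 4 * (eta X).toReal :=
      norm_le_mul_eta hK hκ hv hvκ (hq.forall.2 fun a => hvq a ▸ ⟨a, rfl⟩) X hX
    -- `X` is the image of matrices over `A` of norm arbitrarily close to `‖Y‖`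
    have hXY : ‖matOp (X.map fun b => (b : H →L[ℂ] H))‖ ≤ (cbENorm u).toReal * ‖Y‖ := by
      have hlim : Filter.Tendsto (fun s => (cbENorm u).toReal * s) (nhdsWithin ‖Y‖ (Set.Ioi ‖Y‖))
          (nhds ((cbENorm u).toReal * ‖Y‖)) :=
        ((continuous_const.mul continuous_id).tendsto _).mono_left nhdsWithin_le_nhds
      refine ge_of_tendsto hlim ?_
      filter_upwards [self_mem_nhdsWithin] with s hs
      obtain ⟨T, hT, hTs⟩ := exists_matrix_lift_norm_le q hq Y hs
      have h1 : X.map (fun b => (b : H →L[ℂ] H)) = Matrix.of fun i j => u (T i j) := by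
        ext i j : 2
        rw [Matrix.map_apply, ← hX, ← hT, hvq]
        rfl
      rw [h1]
      exact (norm_matOp_map_le_cbENorm_toReal_mul hcb T).trans (by gcongr)
    have hmain : matENorm X ≤ cbENorm u * inducedInvENorm u * repENorm u ^ 4 * eta X := by
      rw [matENorm_eq_ofReal_norm, ← ENNReal.ofReal_toReal hcb.ne, hκ', hK',
        ← ENNReal.ofReal_toReal hη, ← ENNReal.ofReal_pow hK, ← ENNReal.ofReal_mul (by positivity),
        ← ENNReal.ofReal_mul (by positivity), ← ENNReal.ofReal_mul (by positivity)]
      refine ENNReal.ofReal_le_ofReal (hXY.trans ?_)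
      refine (mul_le_mul_of_nonneg_left hY ENNReal.toReal_nonneg).trans_eq ?_
      ring
    calc ENNReal.ofReal lam * matENorm X
        ≤ (cbENorm u * inducedInvENorm u * repENorm u ^ 4)⁻¹ *
            (cbENorm u * inducedInvENorm u * repENorm u ^ 4 * eta X) := by
          rw [one_div] at hle
          gcongr
      _ ≤ 1 * eta X := by
          rw [← mul_assoc]
          gcongr
          exact ENNReal.inv_mul_le_one _
      _ = eta X := one_mul _
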